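/- **Setting.** Let $(\Omega,\mathcal A,\mathbb P)$ be a probability space and $T>0$. Let $S=(S^1,\dots,S^n)$ be a process with continuous paths on $[0,T]$ (the traded stocks) and $Y$ a real càdlàg process on $[0,T]$ (the insurance process), with $\Delta Y_t=Y_t-Y_{t-}$, $\Delta Y_0=0$. Let $\bar{\mathcal F}^S$, $\bar{\mathcal F}^Y$ be the filtrations generated by $S$ and by $Y$, completed by the $\mathbb P$-null events, and $\mathcal F_t=\bar{\mathcal F}^S_t\vee\bar{\mathcal F}^Y_t$. Stopping times are $\mathcal F$-stopping times with values in $[0,T]$. Equalities, inequalities and limits of random variables are a.s.; $L^\infty(\mathcal G)$ is the space of bounded $\mathcal G$-measurable random variables and $L^\infty_+(\mathcal G)$ the set of its non-negative elements. The market is arbitrage free and complete: there is on $\bar{\mathcal F}^S_T$ a unique probability measure $\mathbb Q$ equivalent to $\mathbb P$ under which $S$ is an $\bar{\mathcal F}^S$-martingale on $[0,T]$; it is extended to $\mathcal A$ by its $\bar{\mathcal F}^S_T$-measurable density. For a stopping time $\sigma$ let $\tau_\sigma=\inf\{t>\sigma:\Delta Y_t\neq0\}\wedge T$. Put $\tau_0=0$,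 $\tau_{i+1}=\tau_{\tau_i}$, so that $\tau_i$ is the time of the $i$-th jump of $Y$, and $\tau_i=T$ if there are fewer than $i$ jumps. Assume that a.s. $Y$ has only finitely many jumps; that each $\tau_i$, $i\ge1$, is predictable, i.e. a stopping time for which there are stopping times $\tau_i^k\uparrow\tau_i$ with $\tau_i^k<\tau_i$ on $\{\tau_i>0\}$; and that no information is added to $\bar{\mathcal F}^Y$ between jumps: for every $i\ge0$, $\tau_i$ is an $\bar{\mathcal F}^Y$-stopping time and $\bar{\mathcal F}^Y_{\tau_{i+1}-}\subseteq\bar{\mathcal F}^Y_{\tau_i}$, where $\bar{\mathcal F}^Y_{\tau-}$ is generated by the process equal to $Y$ on $[0,\tau)$ and to $Y_{\tau-}$ from $\tau$ on. **Evaluations.** For $\sigma$-algebras $\mathcal G\subseteq\mathcal H$, a $\mathcal G$-conditional evaluation on $L^\infty(\mathcal H)$ is a map $\Pi:L^\infty(\mathcal H)\to L^\infty(\mathcal G)$ such that: $\Pi(0)=0$; $\Pi(H+m)=\Pi(H)+m$ for $m\in L^\infty(\mathcal G)$; $\Pi(\lambda H_1+(1-\lambda)H_2)\le\lambda\Pi(H_1)+(1-\lambda)\Pi(H_2)$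 for $\lambda\in L^\infty(\mathcal G)$, $0\le\lambda\le1$; $\Pi(I_AH_1+I_{A^c}H_2)=I_A\Pi(H_1)+I_{A^c}\Pi(H_2)$ for $A\in\mathcal G$; and $\Pi(H)\le\liminf_k\Pi(H_k)$ whenever $(H_k)$ is uniformly bounded and $H_k\to H$. It is * *continuous* if $\Pi(H_k)\to\Pi(H)$ for all such sequences; * *monotone* if $H_1\le H_2$ implies $\Pi(H_1)\le\Pi(H_2)$; * *positively homogeneous* if $\Pi(\lambda H)=\lambda\Pi(H)$ for $\lambda\in L^\infty_+(\mathcal G)$; * *$p$-norm bounded* if for some $p\in[1,\infty)$, $\lambda\in L^\infty_+(\mathcal G)$ and some probability measure $\bar{\mathbb P}$ with the same null sets as $\mathbb P$, $\Pi(H)\le\lambda\,E_{\bar{\mathbb P}}[|H|^p\mid\mathcal G]$ for all $H\in L^\infty(\mathcal H)$. A dynamic evaluation is a family $(\Pi_\sigma)$, $\sigma$ ranging over all stopping times, of $\mathcal F_\sigma$-conditional evaluations on $L^\infty(\mathcal F_T)$ which is time-consistent: $\Pi_\sigma(H)=\Pi_\sigma(\Pi_\tau(H))$ for $\sigma\le\tau$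 and $H\in L^\infty(\mathcal F_T)$. It is market-consistent if $\Pi_\sigma(H^S+H)=E_{\mathbb Q}[H^S\mid\mathcal F_\sigma]+\Pi_\sigma(H)$ for all $\sigma$, all $H^S\in L^\infty(\bar{\mathcal F}^S_T\vee\mathcal F_\sigma)$ and all $H\in L^\infty(\mathcal F_T)$. **Theorem.** Let $(\Pi_\sigma)$ be a time-consistent and market-consistent dynamic evaluation such that every $\Pi_\sigma$ is continuous. For a stopping time $\sigma$ put $\mathcal F^S_{\tau_\sigma}=\sigma(S_{t\wedge\tau_\sigma}:t\ge0)\vee\mathcal F_\sigma$, and let $\Pi_{\sigma,\tau_\sigma}$ be the restriction of $\Pi_\sigma$ to $L^\infty(\mathcal F_{\tau_\sigma})$. Then for every stopping time $\sigma$, $\tau_\sigma$ is a stopping time and $\Pi_{\sigma,\tau_\sigma}$ has the market local property: for all $A\in\mathcal F^S_{\tau_\sigma}$ and $H\in L^\infty_+(\mathcal F_{\tau_\sigma})$, $$\Pi_\sigma(H)=\Pi_\sigma(I_AH)+\Pi_\sigma(I_{A^c}H).$$ If moreover all $\Pi_\rho$ are monotone, or all are $p$-norm bounded, or all are positively homogeneous,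 then for every stopping time $\sigma$ there is an $\mathcal F^S_{\tau_\sigma}$-conditional evaluation $\Pi_{\mathcal F^S_{\tau_\sigma}}:L^\infty(\mathcal F_{\tau_\sigma})\to L^\infty(\mathcal F^S_{\tau_\sigma})$ with $$\Pi_{\sigma,\tau_\sigma}(H)=E_{\mathbb Q}\big[\Pi_{\mathcal F^S_{\tau_\sigma}}(H)\,\big|\,\mathcal F_\sigma\big]\qquad\text{for all }H\in L^\infty(\mathcal F_{\tau_\sigma}).$$ -/

import Mathlib

open MeasureTheory Filter Topology
open scoped NNReal

noncomputable section

namespace MarketEval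

section Static

variable {Ω : Type*} {m : MeasurableSpace Ω}

/-! ### Bounded payoffs and conditional evaluations

Random variables are real functions on `Ω`, identified when they agree almost surely. -/

/-- `H ∈ L^∞(𝓖)`: `H` is a.s. equal to a `𝓖`-measurable variable and a.s. bounded. -/
def Linf (P : Measure Ω) (𝓖 : MeasurableSpace Ω) (H : Ω → ℝ) : Prop :=
  AEStronglyMeasurable[𝓖] H P ∧ ∃ C : ℝ, ∀ᵐ ω ∂P, |H ω| ≤ C

/-- `H ∈ L^∞₊(𝓖)`. -/
def LinfPos (P : Measure Ω) (𝓖 : MeasurableSpace Ω) (H : Ω → ℝ) : Prop :=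
  Linf P 𝓖 H ∧ ∀ᵐ ω ∂P, 0 ≤ H ω

/-- A sequence in `L^∞(𝓗)`, bounded uniformly, which converges a.s. to `H ∈ L^∞(𝓗)`. -/
structure BoundedConv (P : Measure Ω) (𝓗 : MeasurableSpace Ω) (Hs : ℕ → Ω → ℝ) (H : Ω → ℝ) :
    Prop where
  seq_mem : ∀ k, Linf P 𝓗 (Hs k)
  lim_mem : Linf P 𝓗 H
  bounded : ∃ C : ℝ, ∀ k, ∀ᵐ ω ∂P, |Hs k ω| ≤ C
  tendsto : ∀ᵐ ω ∂P, Tendsto (fun k => Hs k ω) atTop (𝓝 (H ω))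

/-- `V` is a `𝓖`-conditional evaluation `L^∞(𝓗) → L^∞(𝓖)`. -/
structure IsConditionalEvaluation (P : Measure Ω) (𝓗 𝓖 : MeasurableSpace Ω)
    (V : (Ω → ℝ) → Ω → ℝ) : Prop where
  /-- `V` takes values in `L^∞(𝓖)`. -/
  mem : ∀ H, Linf P 𝓗 H → Linf P 𝓖 (V H)
  /-- `V` is well defined on a.s. classes. -/
  congr : ∀ H₁ H₂, Linf P 𝓗 H₁ → Linf P 𝓗 H₂ → H₁ =ᵐ[P] H₂ → V H₁ =ᵐ[P] V H₂
  /-- Normalization. -/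
  normalized : V 0 =ᵐ[P] 0
  /-- Cash invariance. -/
  cash : ∀ H c, Linf P 𝓗 H → Linf P 𝓖 c → V (H + c) =ᵐ[P] V H + c
  /-- Convexity with `𝓖`-measurable weights. -/
  convex : ∀ H₁ H₂ l, Linf P 𝓗 H₁ → Linf P 𝓗 H₂ → Linf P 𝓖 l →
    (∀ᵐ ω ∂P, 0 ≤ l ω ∧ l ω ≤ 1) →
    V (l * H₁ + (1 - l) * H₂) ≤ᵐ[P] l * V H₁ + (1 - l) * V H₂
  /-- The local property. -/
  isLocal : ∀ H₁ H₂ A, Linf P 𝓗 H₁ → Linf P 𝓗 H₂ → MeasurableSet[𝓖] A →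
    V (A.indicator H₁ + Aᶜ.indicator H₂) =ᵐ[P] A.indicator (V H₁) + Aᶜ.indicator (V H₂)
  /-- The Fatou property; the lower limit is taken in the extended reals. -/
  fatou : ∀ Hs H, BoundedConv P 𝓗 Hs H →
    ∀ᵐ ω ∂P, ((V H ω : ℝ) : EReal) ≤ liminf (fun k => ((V (Hs k) ω : ℝ) : EReal)) atTop

/-- Monotonicity on `L^∞(𝓗)`. -/
def IsMonotoneEval (P : Measure Ω) (𝓗 : MeasurableSpace Ω) (V : (Ω → ℝ) → Ω → ℝ) : Prop :=
  ∀ H₁ H₂, Linf P 𝓗 H₁ → Linf P 𝓗 H₂ → H₁ ≤ᵐ[P] H₂ → V H₁ ≤ᵐ[P] V H₂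

/-- `𝓖`-positive homogeneity on `L^∞(𝓗)`. -/
def IsPosHomEval (P : Measure Ω) (𝓗 𝓖 : MeasurableSpace Ω) (V : (Ω → ℝ) → Ω → ℝ) : Prop :=
  ∀ H l, Linf P 𝓗 H → LinfPos P 𝓖 l → V (l * H) =ᵐ[P] l * V H

/-- `p`-norm boundedness on `L^∞(𝓗)`: for some `p ∈ [1, ∞)`, some `l ∈ L^∞₊(𝓖)` and some
probability measure `R` with the null sets of `P`, `V H ≤ l * E_R[|H|^p | 𝓖]` for all `H`. -/
def IsPNormBounded (P : Measure Ω) (𝓗 𝓖 : MeasurableSpace Ω) (V : (Ω → ℝ) → Ω → ℝ) : Prop :=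
  ∃ p : ℝ, 1 ≤ p ∧ ∃ l : Ω → ℝ, LinfPos P 𝓖 l ∧
    ∃ R : @Measure Ω m, IsProbabilityMeasure R ∧ R ≪ P ∧ P ≪ R ∧
      ∀ H, Linf P 𝓗 H → V H ≤ᵐ[P] l * R[fun ω => |H ω| ^ p | 𝓖]

/-- Continuity on `L^∞(𝓗)` with respect to bounded a.s. convergence. -/
def IsContinuousEval (P : Measure Ω) (𝓗 : MeasurableSpace Ω) (V : (Ω → ℝ) → Ω → ℝ) : Prop :=
  ∀ Hs H, BoundedConv P 𝓗 Hs H →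
    ∀ᵐ ω ∂P, Tendsto (fun k => V (Hs k) ω) atTop (𝓝 (V H ω))

/-- The market local property of `V` on `L^∞(𝓗)`, with respect to the market information `𝓢`. -/
def MarketLocalProperty (P : Measure Ω) (𝓗 𝓢 : MeasurableSpace Ω) (V : (Ω → ℝ) → Ω → ℝ) :
    Prop :=
  ∀ A H, MeasurableSet[𝓢] A → LinfPos P 𝓗 H →
    V H =ᵐ[P] V (A.indicator H) + V (Aᶜ.indicator H)

/-- `V : L^∞(𝓗) → L^∞(𝓖)` is a two step market evaluation: there is an `𝓢`-conditional
evaluation `W : L^∞(𝓗) → L^∞(𝓢)` with `V H = E_Q[W H | 𝓖]`. -/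
def IsTwoStepMarketEvaluation (P Q : Measure Ω) (𝓗 𝓢 𝓖 : MeasurableSpace Ω)
    (V : (Ω → ℝ) → Ω → ℝ) : Prop :=
  ∃ W : (Ω → ℝ) → Ω → ℝ, IsConditionalEvaluation P 𝓗 𝓢 W ∧
    ∀ H, Linf P 𝓗 H → V H =ᵐ[P] Q[W H | 𝓖]

end Static

section Filtrations

variable {Ω : Type*} {m : MeasurableSpace Ω}

/-- The σ-algebra of the events of probability zero and their complements. -/
@[reducible] def nullEvents (P : Measure Ω) : MeasurableSpace Ω where
  MeasurableSet' A := MeasurableSet[m] A ∧ (P A = 0 ∨ P Aᶜ = 0)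
  measurableSet_empty := ⟨MeasurableSet.empty, Or.inl measure_empty⟩
  measurableSet_compl A hA := ⟨hA.1.compl, by rw [compl_compl]; exact hA.2.symm⟩
  measurableSet_iUnion f hf := by
    refine ⟨MeasurableSet.iUnion fun i => (hf i).1, ?_⟩
    by_cases h : ∀ i, P (f i) = 0
    · exact Or.inl (measure_iUnion_null h)
    · push Not at h
      obtain ⟨i, hi⟩ := h
      refine Or.inr (measure_mono_null ?_ ((hf i).2.resolve_left hi))
      exact Set.compl_subset_compl.mpr (Set.subset_iUnion f i)

theorem nullEvents_le (P : Measure Ω) : nullEvents P ≤ m := fun _ hA => hA.1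

/-- The filtration generated by the process `X`, completed by the null events of `P`. -/
def generatedFiltration {β : Type*} [TopologicalSpace β] [TopologicalSpace.MetrizableSpace β]
    [MeasurableSpace β] [BorelSpace β] (P : Measure Ω) (X : ℝ≥0 → Ω → β)
    (hX : ∀ t, StronglyMeasurable (X t)) : Filtration ℝ≥0 m :=
  Filtration.natural X hX ⊔ Filtration.const ℝ≥0 (nullEvents P) (nullEvents_le P)

/-- A stopping time of `𝓕` with values in `[0, T]`. -/
structure BddStoppingTime (𝓕 : Filtration ℝ≥0 m) (T : ℝ≥0) where
  val : Ω → ℝ≥0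
  isStoppingTime : IsStoppingTime 𝓕 (fun ω => ((val ω : ℝ≥0) : WithTop ℝ≥0))
  le : ∀ ω, val ω ≤ T

/-- The σ-algebra `𝓕_σ` of the events known at the stopping time `σ`. -/
@[reducible] def BddStoppingTime.past {𝓕 : Filtration ℝ≥0 m} {T : ℝ≥0} (σ : BddStoppingTime 𝓕 T) :
    MeasurableSpace Ω :=
  σ.isStoppingTime.measurableSpace

/-- The random time `τ` is a predictable stopping time: it is announced by stopping times
`ρ k ↑ τ` with `ρ k < τ` (where `τ > 0`). -/
def IsPredictableTime (P : Measure Ω) (𝓕 : Filtration ℝ≥0 m) (τ : Ω → ℝ≥0) : Prop :=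
  IsStoppingTime 𝓕 (fun ω => ((τ ω : ℝ≥0) : WithTop ℝ≥0)) ∧
  ∃ ρ : ℕ → Ω → ℝ≥0,
    (∀ k, IsStoppingTime 𝓕 (fun ω => ((ρ k ω : ℝ≥0) : WithTop ℝ≥0))) ∧
    ∀ᵐ ω ∂P, Monotone (fun k => ρ k ω) ∧ Tendsto (fun k => ρ k ω) atTop (𝓝 (τ ω)) ∧
      (0 < τ ω → ∀ k, ρ k ω < τ ω)

end Filtrations

section Jumps

variable {Ω : Type*} {m : MeasurableSpace Ω}

/-- `y` is right-continuous on `[0, T)` and has left limits on `(0, T]`. -/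
def IsCadlagUpTo (T : ℝ≥0) (y : ℝ≥0 → ℝ) : Prop :=
  (∀ t < T, ContinuousWithinAt y (Set.Ioi t) t) ∧
  ∀ t, 0 < t → t ≤ T → ∃ l, Tendsto y (𝓝[<] t) (𝓝 l)

/-- The times at which the path `y` jumps, `Δy_t = y_t - y_{t-} ≠ 0` (with `Δy_0 = 0`). -/
def jumpSet (y : ℝ≥0 → ℝ) : Set ℝ≥0 := {t | y t - Function.leftLim y t ≠ 0}

/-- The time of the next jump after `σ`, `inf {t > σ | ΔY_t ≠ 0} ∧ T`. -/
def nextJump (T : ℝ≥0) (Y : ℝ≥0 → Ω → ℝ) (σ : Ω → ℝ≥0) (ω : Ω) : ℝ≥0 :=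
  sInf ({t | σ ω < t ∧ t ∈ jumpSet (fun s => Y s ω)} ∪ {T})

/-- `jumpTime T Y i` is the time of the `i`-th jump of `Y` on `(0, T]`, and `T` if there are
fewer jumps; `jumpTime T Y 0 = 0`. -/
def jumpTime (T : ℝ≥0) (Y : ℝ≥0 → Ω → ℝ) : ℕ → Ω → ℝ≥0
  | 0 => fun _ => 0
  | i + 1 => nextJump T Y (jumpTime T Y i)

/-- The information of `Y` strictly before the random time `τ`: the σ-algebra generated by the
process which follows `Y` on `[0, τ)` and is equal to `Y_{τ-}` from `τ` on. -/
@[reducible] def strictPast (Y : ℝ≥0 → Ω → ℝ) (τ : Ω → ℝ≥0) : MeasurableSpace Ω :=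
  ⨆ t : ℝ≥0, MeasurableSpace.comap
    (fun ω => if t < τ ω then Y t ω else Function.leftLim (fun s => Y s ω) (τ ω)) inferInstance

/-- The σ-algebra generated by the process `S` stopped at the random time `τ`. -/
@[reducible] def stoppedInfo {β : Type*} [MeasurableSpace β] (S : ℝ≥0 → Ω → β) (τ : Ω → ℝ≥0) :
    MeasurableSpace Ω :=
  ⨆ t : ℝ≥0, MeasurableSpace.comap (fun ω => S (min t (τ ω)) ω) inferInstance

/-- The insurance process `Y` is càdlàg on `[0, T]`, a.s. jumps only finitely often, its jump times
are predictable in the filtration `𝓕`, and in its own filtration `𝓕Y` no information arrives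
strictly between the `i`-th and the `(i+1)`-th jump. -/
structure IsInsuranceProcess (P : Measure Ω) (T : ℝ≥0) (𝓕 𝓕Y : Filtration ℝ≥0 m)
    (Y : ℝ≥0 → Ω → ℝ) : Prop where
  cadlag : ∀ ω, IsCadlagUpTo T (fun t => Y t ω)
  finite_jumps : ∀ᵐ ω ∂P, {t | t ≤ T ∧ t ∈ jumpSet (fun s => Y s ω)}.Finite
  predictable : ∀ i, IsPredictableTime P 𝓕 (jumpTime T Y (i + 1))
  no_news : ∀ i, ∃ h : IsStoppingTime 𝓕Y (fun ω => ((jumpTime T Y i ω : ℝ≥0) : WithTop ℝ≥0)),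
    strictPast Y (jumpTime T Y (i + 1)) ≤ h.measurableSpace

end Jumps

section Market

variable {Ω : Type*} {m : MeasurableSpace Ω}

/-- `Q` is a probability measure equivalent to `P` under which the components of `S` are
martingales on `[0, T]` in the filtration `𝓕S`. -/
structure IsMartingaleMeasure {n : ℕ} (P : Measure Ω) (T : ℝ≥0) (𝓕S : Filtration ℝ≥0 m)
    (S : ℝ≥0 → Ω → Fin n → ℝ) (Q : Measure Ω) : Prop where
  isProb : IsProbabilityMeasure Q
  ac : Q ≪ P
  ac' : P ≪ Q
  martingale : ∀ i, Martingale (fun t ω => S (min t T) ω i) 𝓕S Q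

/-- The market is arbitrage free and complete, with pricing measure `Q`: on `𝓕S_T`, `Q` is the only
equivalent martingale measure, and `Q` is extended to all events by its `𝓕S_T`-measurable
density. -/
structure IsPricingMeasure {n : ℕ} (P : Measure Ω) (T : ℝ≥0) (𝓕S : Filtration ℝ≥0 m)
    (S : ℝ≥0 → Ω → Fin n → ℝ) (Q : Measure Ω) : Prop where
  isMartingaleMeasure : IsMartingaleMeasure P T 𝓕S S Q
  unique : ∀ Q' : Measure Ω, IsMartingaleMeasure P T 𝓕S S Q' →
    ∀ A, MeasurableSet[𝓕S T] A → Q' A = Q A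
  density : ∃ ξ : Ω → ENNReal, Measurable[𝓕S T] ξ ∧ Q = P.withDensity ξ

end Market

section Dynamic

variable {Ω : Type*} {m : MeasurableSpace Ω}

/-- `(V σ)`, indexed by the stopping times with values in `[0, T]`, is a time-consistent dynamic
evaluation. -/
structure IsDynamicEvaluation (P : Measure Ω) (T : ℝ≥0) (𝓕 : Filtration ℝ≥0 m)
    (V : BddStoppingTime 𝓕 T → (Ω → ℝ) → Ω → ℝ) : Prop where
  evaluation : ∀ σ, IsConditionalEvaluation P (𝓕 T) σ.past (V σ)
  time_consistent : ∀ σ τ : BddStoppingTime 𝓕 T, (∀ ω, σ.val ω ≤ τ.val ω) →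
    ∀ H, Linf P (𝓕 T) H → V σ H =ᵐ[P] V σ (V τ H)

/-- Market-consistency of a dynamic evaluation: for all financial payoffs
`HS ∈ L^∞(𝓕S_T ∨ 𝓕_σ)` and all `H ∈ L^∞(𝓕_T)`, `V σ (HS + H) = E_Q[HS | 𝓕_σ] + V σ H`. -/
def IsMarketConsistent (P Q : Measure Ω) (T : ℝ≥0) (𝓕 𝓕S : Filtration ℝ≥0 m)
    (V : BddStoppingTime 𝓕 T → (Ω → ℝ) → Ω → ℝ) : Prop :=
  ∀ σ : BddStoppingTime 𝓕 T, ∀ HS H, Linf P (𝓕S T ⊔ σ.past) HS → Linf P (𝓕 T) H →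
    V σ (HS + H) =ᵐ[P] Q[HS | σ.past] + V σ H

end Dynamic

end MarketEval

end

noncomputable section

namespace MarketEval

/-! ### Algebra of `L^∞` and measurable selection -/

section BoundedVariables

variable {Ω : Type*} {𝓖 𝓗 : MeasurableSpace Ω} {m : MeasurableSpace Ω} {P : Measure Ω}

/-! Write `𝓢` for the σ-algebra generated by the stocks stopped at the next jump `τ` and by the past
`𝓕_σ`. The proof rests on stopping times `ρ k ↑ τ` with `σ ≤ ρ k` that announce this jump. Strictly
before it, `Y` reveals nothing beyond `𝓕_σ`, so whatever is learnt up to `ρ k` comes from the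
stocks. Hence `𝓕_{ρ k}` lies in `𝓕S_T ∨ 𝓕_σ` and in `𝓢` (`Announces.past_le_of_stock`), and
continuity of the stock paths gives `⨆ k, 𝓕_{ρ k} = 𝓢`.

Market local property: for `A ∈ 𝓕_{ρ k}`, locality of `V (ρ k)` splits `V (ρ k) H` along `A`. The
pieces belong to `L^∞(𝓕S_T ∨ 𝓕_σ)`, where market-consistency makes `V σ` the linear map `E_Q[· |
𝓕_σ]`, so time-consistency carries the splitting over to `V σ` (`IsMarketConsistent.split_of_past`).
A general `A ∈ 𝓢` is approximated by events of the `𝓕_{ρ k}`, and continuity of `V σ` passes to the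
limit (`IsMarketConsistent.split`).

Two-step representation: by the splitting and continuity, `A ↦ E_Q[V σ (1_A H)]` is countably
additive on `𝓢`, and `W H` is its Radon-Nikodym density. Dominated convergence needs `V σ` to be
bounded on bounded sets, and each of the three alternative hypotheses supplies this. The axioms for
`W` follow by integrating over events of `𝓢`; Fatou and convexity with random weights also need
measurable selections.

The delicate point is that `W H` is bounded, not merely integrable. One has `E_Q[W H | 𝓕_{ρ k}] = V
(ρ k) H` (`IsMarketDensity.condExp_past`), and this martingale converges to `W H`. Pasting the times
`ρ (κ j)` on disjoint events gives a single stopping time, whose evaluation is bounded, so the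
martingale is uniformly bounded along disjoint events (`IsDynamicEvaluation.bounded_on_disjoint`). A
gliding hump argument (`ae_bounded_of_forall_disjoint`) turns this into a bound for `W H`. -/

theorem Linf.mono (h : 𝓖 ≤ 𝓗) {H : Ω → ℝ} (hH : Linf P 𝓖 H) : Linf P 𝓗 H :=
  ⟨hH.1.mono h, hH.2⟩

theorem Linf.congr {H H' : Ω → ℝ} (hH : Linf P 𝓖 H) (h : H =ᵐ[P] H') : Linf P 𝓖 H' := by
  refine ⟨hH.1.congr h, ?_⟩
  obtain ⟨C, hC⟩ := hH.2
  refine ⟨C, ?_⟩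
  filter_upwards [hC, h] with ω h1 h2
  rwa [← h2]

theorem linf_const (c : ℝ) : Linf P 𝓖 (fun _ => c) :=
  ⟨aestronglyMeasurable_const, |c|, by simp⟩

theorem linf_zero : Linf P 𝓖 (0 : Ω → ℝ) := linf_const 0

theorem Linf.add {H K : Ω → ℝ} (hH : Linf P 𝓖 H) (hK : Linf P 𝓖 K) : Linf P 𝓖 (H + K) := by
  refine ⟨hH.1.add hK.1, ?_⟩
  obtain ⟨C, hC⟩ := hH.2
  obtain ⟨D, hD⟩ := hK.2
  refine ⟨C + D, ?_⟩
  filter_upwards [hC, hD] with ω h1 h2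
  exact (abs_add_le _ _).trans (add_le_add h1 h2)

theorem Linf.mul {H K : Ω → ℝ} (hH : Linf P 𝓖 H) (hK : Linf P 𝓖 K) : Linf P 𝓖 (H * K) := by
  refine ⟨hH.1.mul hK.1, ?_⟩
  obtain ⟨C, hC⟩ := hH.2
  obtain ⟨D, hD⟩ := hK.2
  refine ⟨C * D, ?_⟩
  filter_upwards [hC, hD] with ω h1 h2
  rw [Pi.mul_apply, abs_mul]
  exact mul_le_mul h1 h2 (abs_nonneg _) ((abs_nonneg _).trans h1)

theorem Linf.neg {H : Ω → ℝ} (hH : Linf P 𝓖 H) : Linf P 𝓖 (-H) := by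
  refine ⟨hH.1.neg, ?_⟩
  obtain ⟨C, hC⟩ := hH.2
  exact ⟨C, by simpa using hC⟩

theorem Linf.sub {H K : Ω → ℝ} (hH : Linf P 𝓖 H) (hK : Linf P 𝓖 K) : Linf P 𝓖 (H - K) := by
  rw [sub_eq_add_neg]; exact hH.add hK.neg

theorem Linf.indicator {H : Ω → ℝ} (hH : Linf P 𝓖 H) {A : Set Ω} (hA : MeasurableSet[𝓖] A) :
    Linf P 𝓖 (A.indicator H) := by
  obtain ⟨g, hg, hHg⟩ := hH.1
  refine ⟨⟨A.indicator g, hg.indicator hA, ?_⟩, ?_⟩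
  · filter_upwards [hHg] with ω h
    by_cases hω : ω ∈ A <;> simp [hω, h]
  · obtain ⟨C, hC⟩ := hH.2
    refine ⟨C, ?_⟩
    filter_upwards [hC] with ω h
    by_cases hω : ω ∈ A
    · simpa [hω] using h
    · simpa [hω] using (abs_nonneg _).trans h

theorem Linf.aestronglyMeasurable (h𝓖 : 𝓖 ≤ m) {H : Ω → ℝ} (hH : Linf P 𝓖 H) :
    AEStronglyMeasurable H P := hH.1.mono h𝓖

theorem Linf.integrable {Q : Measure Ω} [IsFiniteMeasure Q] (hQP : Q ≪ P) (h𝓖 : 𝓖 ≤ m)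
    {H : Ω → ℝ} (hH : Linf P 𝓖 H) : Integrable H Q := by
  obtain ⟨C, hC⟩ := hH.2
  refine Integrable.of_bound ((hH.aestronglyMeasurable h𝓖).mono_ac hQP) C ?_
  exact hQP.ae_le (hC.mono fun ω h => by simpa using h)

/-- Bounded variables selected by a countably valued measurable index. -/
theorem linf_select {Hs : ℕ → Ω → ℝ} {C : ℝ} (hHs : ∀ k, Linf P 𝓗 (Hs k))
    (hC : ∀ k, ∀ᵐ ω ∂P, |Hs k ω| ≤ C) {ν : Ω → ℕ} (hν : Measurable[𝓗] ν) :
    Linf P 𝓗 (fun ω => Hs (ν ω) ω) := by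
  choose g hg hHg using fun k => (hHs k).1
  refine ⟨⟨fun ω => g (ν ω) ω, ?_, ?_⟩, C, ?_⟩
  · have h1 : Measurable[𝓗] (fun ω => g (ν ω) ω) := by
      have h2 : ∀ U : Set ℝ, (fun ω => g (ν ω) ω) ⁻¹' U = ⋃ n, (ν ⁻¹' {n} ∩ g n ⁻¹' U) := by
        intro U; ext ω; simp
      intro U hU
      rw [h2]
      exact MeasurableSet.iUnion fun n =>
        (hν (measurableSet_singleton n)).inter ((hg n).measurable hU)
    exact h1.stronglyMeasurable
  · filter_upwards [ae_all_iff.2 hHg] with ω h using h _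
  · filter_upwards [ae_all_iff.2 hC] with ω h using h _

end BoundedVariables

/-! ### Consequences of locality, cash invariance and convexity -/

section LocalMaps

variable {Ω : Type*} {𝓖 𝓗 : MeasurableSpace Ω} {m : MeasurableSpace Ω} {P : Measure Ω}
  {V : (Ω → ℝ) → Ω → ℝ}

/-- A map on `L^∞(𝓗)` which is well defined on a.s. classes and `𝓖`-local. -/
structure IsLocalMap (P : Measure Ω) (𝓗 𝓖 : MeasurableSpace Ω) (V : (Ω → ℝ) → Ω → ℝ) : Prop where
  congr : ∀ H₁ H₂, Linf P 𝓗 H₁ → Linf P 𝓗 H₂ → H₁ =ᵐ[P] H₂ → V H₁ =ᵐ[P] V H₂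
  isLocal : ∀ H₁ H₂ A, Linf P 𝓗 H₁ → Linf P 𝓗 H₂ → MeasurableSet[𝓖] A →
    V (A.indicator H₁ + Aᶜ.indicator H₂) =ᵐ[P] A.indicator (V H₁) + Aᶜ.indicator (V H₂)

theorem IsConditionalEvaluation.isLocalMap (hV : IsConditionalEvaluation P 𝓗 𝓖 V) :
    IsLocalMap P 𝓗 𝓖 V := ⟨hV.congr, hV.isLocal⟩

theorem IsLocalMap.ae_eq_on (hV : IsLocalMap P 𝓗 𝓖 V) (h𝓖 : 𝓖 ≤ 𝓗) {H₁ H₂ : Ω → ℝ} {A : Set Ω}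
    (h₁ : Linf P 𝓗 H₁) (h₂ : Linf P 𝓗 H₂) (hA : MeasurableSet[𝓖] A)
    (h : ∀ᵐ ω ∂P, ω ∈ A → H₁ ω = H₂ ω) : ∀ᵐ ω ∂P, ω ∈ A → V H₁ ω = V H₂ ω := by
  have hz : Linf P 𝓗 (0 : Ω → ℝ) := linf_zero
  have e1 := hV.isLocal H₁ 0 A h₁ hz hA
  have e2 := hV.isLocal H₂ 0 A h₂ hz hA
  have hA' : MeasurableSet[𝓗] A := h𝓖 _ hA
  have e3 := hV.congr (A.indicator H₁ + Aᶜ.indicator 0) (A.indicator H₂ + Aᶜ.indicator 0)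
    ((h₁.indicator hA').add (hz.indicator hA'.compl))
    ((h₂.indicator hA').add (hz.indicator hA'.compl)) (by
      filter_upwards [h] with ω hω
      by_cases hωA : ω ∈ A <;> simp [hωA, hω])
  filter_upwards [e1, e2, e3] with ω h1 h2 h3 hωA
  rw [h1, h2] at h3
  simpa [hωA] using h3

/-- Locality on each of the countably many events `{ν = n}`. This evaluates payoffs whose index is
chosen pointwise, the device behind all selection arguments below. -/
theorem IsLocalMap.select (hV : IsLocalMap P 𝓗 𝓖 V) (h𝓖 : 𝓖 ≤ 𝓗) {Hs : ℕ → Ω → ℝ} {C : ℝ}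
    (hHs : ∀ k, Linf P 𝓗 (Hs k)) (hC : ∀ k, ∀ᵐ ω ∂P, |Hs k ω| ≤ C) {ν : Ω → ℕ}
    (hν : Measurable[𝓖] ν) :
    V (fun ω => Hs (ν ω) ω) =ᵐ[P] fun ω => V (Hs (ν ω)) ω := by
  have hL := linf_select hHs hC (hν.mono h𝓖 le_rfl)
  have : ∀ n, ∀ᵐ ω ∂P, ω ∈ ν ⁻¹' {n} → V (fun ω => Hs (ν ω) ω) ω = V (Hs n) ω := fun n =>
    hV.ae_eq_on h𝓖 hL (hHs n) (hν (measurableSet_singleton n))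
      (Eventually.of_forall fun ω hω => by
        have : ν ω = n := hω
        simp [this])
  filter_upwards [ae_all_iff.2 this] with ω h
  exact h _ rfl

theorem IsConditionalEvaluation.const (hV : IsConditionalEvaluation P 𝓗 𝓖 V) {c : Ω → ℝ}
    (hc : Linf P 𝓖 c) : V c =ᵐ[P] c := by
  have h1 := hV.cash 0 c linf_zero hc
  rw [zero_add] at h1
  filter_upwards [h1, hV.normalized] with ω h1 h2
  simp [h1, h2]

theorem IsConditionalEvaluation.indicator (hV : IsConditionalEvaluation P 𝓗 𝓖 V) {H : Ω → ℝ}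
    (hH : Linf P 𝓗 H) {A : Set Ω} (hA : MeasurableSet[𝓖] A) :
    V (A.indicator H) =ᵐ[P] A.indicator (V H) := by
  have h1 := hV.isLocal H 0 A hH linf_zero hA
  have h2 : A.indicator H + Aᶜ.indicator 0 = A.indicator H := by ext ω; simp
  rw [h2] at h1
  filter_upwards [h1, hV.normalized] with ω h1 h2
  rw [h1, Pi.add_apply]
  by_cases hω : ω ∈ A <;> simp [hω, h2]

/-- Convexity at the midpoint of `H` and `-H`, together with `V 0 = 0`. -/
theorem IsConditionalEvaluation.neg_le (hV : IsConditionalEvaluation P 𝓗 𝓖 V) {H : Ω → ℝ}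
    (hH : Linf P 𝓗 H) : ∀ᵐ ω ∂P, -V (-H) ω ≤ V H ω := by
  have h1 := hV.convex H (-H) (fun _ => 1 / 2) hH hH.neg (linf_const _)
    (Eventually.of_forall fun ω => by norm_num)
  have h2 : (fun _ => (1 / 2 : ℝ)) * H + (1 - fun _ => (1 / 2 : ℝ)) * -H = (0 : Ω → ℝ) := by
    ext ω; simp only [Pi.add_apply, Pi.mul_apply, Pi.sub_apply, Pi.neg_apply, Pi.one_apply,
      Pi.zero_apply]; ring
  rw [h2] at h1
  filter_upwards [h1, hV.normalized] with ω h1 h2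
  rw [h2] at h1
  simp only [Pi.add_apply, Pi.mul_apply, Pi.sub_apply, Pi.one_apply, Pi.zero_apply] at h1
  linarith

end LocalMaps

/-! ### Boundedness on bounded sets, from each of the three hypotheses -/

section UniformBounds

variable {Ω : Type*} {𝓖 𝓗 : MeasurableSpace Ω} {m : MeasurableSpace Ω} {P : Measure Ω}
  {V : (Ω → ℝ) → Ω → ℝ}

/-- `V` maps bounded subsets of `L^∞(𝓗)` to bounded sets. -/
def IsUniformlyBounded (P : Measure Ω) (𝓗 : MeasurableSpace Ω) (V : (Ω → ℝ) → Ω → ℝ) : Prop :=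
  ∀ C : ℝ, ∃ K : ℝ, ∀ H, Linf P 𝓗 H → (∀ᵐ ω ∂P, |H ω| ≤ C) → ∀ᵐ ω ∂P, |V H ω| ≤ K

theorem IsConditionalEvaluation.isUniformlyBounded_of_upper
    (hV : IsConditionalEvaluation P 𝓗 𝓖 V)
    (h : ∀ C : ℝ, ∃ K : ℝ, ∀ H, Linf P 𝓗 H → (∀ᵐ ω ∂P, |H ω| ≤ C) → ∀ᵐ ω ∂P, V H ω ≤ K) :
    IsUniformlyBounded P 𝓗 V := by
  intro C
  obtain ⟨K, hK⟩ := h C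
  refine ⟨K, fun H hH hC => ?_⟩
  filter_upwards [hK H hH hC, hK (-H) hH.neg (by simpa using hC), hV.neg_le hH] with ω h1 h2 h3
  exact abs_le.2 ⟨by linarith, h1⟩

theorem IsMonotoneEval.isUniformlyBounded (hV : IsConditionalEvaluation P 𝓗 𝓖 V)
    (hm : IsMonotoneEval P 𝓗 V) : IsUniformlyBounded P 𝓗 V := by
  refine hV.isUniformlyBounded_of_upper fun C => ⟨C, fun H hH hC => ?_⟩
  have h1 := hm H (fun _ => C) hH (linf_const C) (hC.mono fun ω h => (le_abs_self _).trans h)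
  filter_upwards [h1, hV.const (linf_const (P := P) (𝓖 := 𝓖) C)] with ω h1 h2
  rwa [h2] at h1

theorem IsPNormBounded.isUniformlyBounded (hV : IsConditionalEvaluation P 𝓗 𝓖 V)
    (h𝓗 : 𝓗 ≤ m) (hp : IsPNormBounded P 𝓗 𝓖 V) : IsUniformlyBounded P 𝓗 V := by
  obtain ⟨p, hp1, l, ⟨⟨_, L, hL⟩, hl0⟩, P', hP', hRP, hPR, hb⟩ := hp
  refine hV.isUniformlyBounded_of_upper fun C => ⟨L * |C| ^ p, fun H hH hC => ?_⟩
  have h0 : ∀ᵐ ω ∂P', |H ω| ^ p ≤ |C| ^ p := by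
    filter_upwards [hRP.ae_le hC] with ω hω
    exact Real.rpow_le_rpow (abs_nonneg _) (hω.trans (le_abs_self _)) (by linarith)
  have hm : AEStronglyMeasurable (fun ω => |H ω| ^ p) P' :=
    (((hH.aestronglyMeasurable h𝓗).mono_ac hRP).aemeasurable.abs.pow_const p).aestronglyMeasurable
  have hint : Integrable (fun ω => |H ω| ^ p) P' := by
    refine Integrable.of_bound hm (|C| ^ p) ?_
    filter_upwards [h0] with ω hω
    rwa [Real.norm_eq_abs, abs_of_nonneg (by positivity)]
  by_cases h𝓖 : 𝓖 ≤ m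
  · have h1 : P'[fun ω => |H ω| ^ p | 𝓖] ≤ᵐ[P'] fun _ => |C| ^ p := by
      have := condExp_mono (m := 𝓖) hint (integrable_const (|C| ^ p)) h0
      rwa [condExp_const h𝓖] at this
    have h2 : 0 ≤ᵐ[P'] P'[fun ω => |H ω| ^ p | 𝓖] :=
      condExp_nonneg (Eventually.of_forall fun ω => by simp only [Pi.zero_apply]; positivity)
    filter_upwards [hb H hH, hPR.ae_le h1, hPR.ae_le h2, hL, hl0] with ω a1 a2 a3 a4 a5
    refine a1.trans ?_
    rw [Pi.mul_apply]
    exact mul_le_mul ((le_abs_self _).trans a4) a2 a3 ((abs_nonneg _).trans a4)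
  -- If `𝓖` is not a sub-σ-algebra, the conditional expectation is `0` by convention and the
  -- hypothesis reads `V H ≤ 0`.
  · filter_upwards [hb H hH, hL] with ω a1 a2
    rw [condExp_of_not_le h𝓖] at a1
    simp only [mul_zero, Pi.zero_apply] at a1
    exact a1.trans (mul_nonneg ((abs_nonneg _).trans a2) (by positivity))

/-- Otherwise some sequence bounded by `C` has values `V (Hs n)` not essentially bounded by `n`. If
these are pointwise unbounded on a non-null event, selecting large ones and scaling them down
contradicts continuity at `0`. If they are pointwise bounded, one selected payoff nearly attains
their supremum, and its value is essentially bounded. -/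
theorem IsPosHomEval.isUniformlyBounded (hV : IsConditionalEvaluation P 𝓗 𝓖 V)
    (h𝓖 : 𝓖 ≤ 𝓗) (hc : IsContinuousEval P 𝓗 V) (hp : IsPosHomEval P 𝓗 𝓖 V) :
    IsUniformlyBounded P 𝓗 V := by
  classical
  by_contra hcon
  unfold IsUniformlyBounded at hcon
  push Not at hcon
  obtain ⟨C, hcon⟩ := hcon
  choose Hs hHs hHC hbad using fun n : ℕ => hcon n
  choose g hg hVg using fun n => (hV.mem _ (hHs n)).1
  have hVg' := ae_all_iff.2 hVg
  have hgm : ∀ n, Measurable[𝓖] fun ω => |g n ω| := fun n =>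
    continuous_abs.measurable.comp (hg n).measurable
  set U : Set Ω := {ω | ∀ k : ℕ, ∃ n, (k : ℝ) < |g n ω|} with hU
  have hUm : MeasurableSet[𝓖] U := by
    have : U = ⋂ k : ℕ, ⋃ n, {ω | (k : ℝ) < |g n ω|} := by ext ω; simp [hU]
    rw [this]
    exact MeasurableSet.iInter fun k => MeasurableSet.iUnion fun n =>
      @measurableSet_lt _ _ _ _ _ 𝓖 _ _ _ _ _ measurable_const (hgm n)
  have hC0 : ∀ᵐ ω ∂P, 0 ≤ C := (hHC 0).mono fun ω h => (abs_nonneg _).trans h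
  -- the unbounded part
  have hU0 : ∀ᵐ ω ∂P, ω ∉ U := by
    have hex : ∀ (k : ℕ) (ω : Ω), ∃ n, (ω ∈ U → ((k + 1 : ℝ)) ^ 2 < |g n ω|) := by
      intro k ω
      by_cases hω : ω ∈ U
      · obtain ⟨n, hn⟩ := hω ((k + 1) ^ 2)
        exact ⟨n, fun _ => by simpa using hn⟩
      · exact ⟨0, fun h => absurd h hω⟩
    have hνm : ∀ k, Measurable[𝓖] fun ω => Nat.find (hex k ω) := by
      intro k
      refine @measurable_find _ 𝓖 _ _ (hex k) fun n => ?_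
      have : {ω | ω ∈ U → ((k + 1 : ℝ)) ^ 2 < |g n ω|} =
          Uᶜ ∪ {ω | ((k + 1 : ℝ)) ^ 2 < |g n ω|} := by
        ext ω; simp [imp_iff_not_or]
      rw [this]
      exact MeasurableSet.union hUm.compl
        (@measurableSet_lt _ _ _ _ _ 𝓖 _ _ _ _ _ measurable_const (hgm n))
    set X : ℕ → Ω → ℝ := fun k ω => Hs (Nat.find (hex k ω)) ω with hX
    have hXL : ∀ k, Linf P 𝓗 (X k) := fun k => linf_select hHs hHC ((hνm k).mono h𝓖 le_rfl)
    have hXC : ∀ k, ∀ᵐ ω ∂P, |X k ω| ≤ C := fun k => by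
      filter_upwards [ae_all_iff.2 hHC] with ω h using h _
    have hXV : ∀ k, V (X k) =ᵐ[P] fun ω => V (Hs (Nat.find (hex k ω))) ω := fun k =>
      hV.isLocalMap.select h𝓖 hHs hHC (hνm k)
    set l : ℕ → Ω → ℝ := fun k _ => 1 / (k + 1 : ℝ) with hl
    have hlp : ∀ k, LinfPos P 𝓖 (l k) := fun k =>
      ⟨linf_const _, Eventually.of_forall fun ω => by simp only [hl]; positivity⟩
    have hlV : ∀ k, V (l k * X k) =ᵐ[P] l k * V (X k) := fun k => hp _ _ (hXL k) (hlp k)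
    -- The selected values exceed `(k + 1) ^ 2` on `U`; scaling by `1 / (k + 1)` sends the payoffs
    -- to `0` but leaves values of modulus at least `k + 1`.
    have hconv : BoundedConv P 𝓗 (fun k => l k * X k) 0 := by
      refine ⟨fun k => (linf_const _).mul (hXL k), linf_zero, ⟨C, fun k => ?_⟩, ?_⟩
      · filter_upwards [hXC k, hC0] with ω h h0
        simp only [Pi.mul_apply, hl, abs_mul]
        rw [abs_of_nonneg (by positivity)]
        refine (mul_le_of_le_one_left (abs_nonneg _) ?_).trans h
        rw [div_le_one (by positivity)]; linarith [(k.cast_nonneg : (0 : ℝ) ≤ k)]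
      · filter_upwards [ae_all_iff.2 hXC] with ω h
        have h1 : Tendsto (fun k : ℕ => 1 / (k + 1 : ℝ) * C) atTop (𝓝 0) := by
          simpa using (tendsto_one_div_add_atTop_nhds_zero_nat (𝕜 := ℝ)).mul_const C
        refine squeeze_zero_norm (fun k => ?_) h1
        simp only [Pi.mul_apply, hl, norm_mul, Real.norm_eq_abs]
        rw [abs_of_nonneg (by positivity : (0 : ℝ) ≤ 1 / (k + 1 : ℝ))]
        exact mul_le_mul_of_nonneg_left (h k) (by positivity)
    filter_upwards [hc _ _ hconv, ae_all_iff.2 hXV, ae_all_iff.2 hlV, hVg', hV.normalized]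
      with ω h1 h2 h3 h4 h5 hωU
    rw [h5] at h1
    have h6 : ∀ k : ℕ, (k + 1 : ℝ) ≤ |V (l k * X k) ω| := by
      intro k
      have h7 := Nat.find_spec (hex k ω) hωU
      rw [h3 k, Pi.mul_apply, h2 k, h4, abs_mul, hl]
      simp only
      rw [abs_of_nonneg (by positivity : (0 : ℝ) ≤ 1 / (k + 1 : ℝ)), div_mul_eq_mul_div, one_mul,
        le_div_iff₀ (by positivity)]
      nlinarith
    have h8 := (h1.abs.eventually (gt_mem_nhds (show |(0 : Ω → ℝ) ω| < 1 by simp))).exists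
    obtain ⟨k, hk⟩ := h8
    linarith [h6 k, (k.cast_nonneg : (0 : ℝ) ≤ k)]
  -- the bounded part
  have hex : ∀ ω : Ω, ∃ n, (ω ∉ U → ∀ j, |g j ω| ≤ |g n ω| + 1) := by
    intro ω
    by_cases hω : ω ∈ U
    · exact ⟨0, fun h => absurd hω h⟩
    · have hb : BddAbove (Set.range fun j => |g j ω|) := by
        simp only [hU, Set.mem_ofPred_eq, not_forall, not_exists, not_lt] at hω
        obtain ⟨k, hk⟩ := hω
        exact ⟨k, by rintro _ ⟨j, rfl⟩; exact hk j⟩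
      obtain ⟨n, hn⟩ := exists_lt_of_lt_ciSup
        (show (⨆ j, |g j ω|) - 1 < ⨆ j, |g j ω| by linarith)
      exact ⟨n, fun _ j => by linarith [le_ciSup hb j]⟩
  have hνm : Measurable[𝓖] fun ω => Nat.find (hex ω) := by
    refine @measurable_find _ 𝓖 _ _ hex fun n => ?_
    have : {ω | ω ∉ U → ∀ j, |g j ω| ≤ |g n ω| + 1} =
        U ∪ ⋂ j, {ω | |g j ω| ≤ |g n ω| + 1} := by
      ext ω; simp only [Set.mem_ofPred_eq, Set.mem_union, Set.mem_iInter]; tauto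
    rw [this]
    exact MeasurableSet.union hUm (MeasurableSet.iInter fun j =>
        (@measurableSet_le _ _ _ _ _ 𝓖 _ _ _ _ _ (hgm j) ((continuous_add_const 1).measurable.comp (hgm n))))
  -- Off `U` the selected value is within `1` of dominating every `|V (Hs n)|`, so `K + 1` bounds
  -- them all; taking `n = N ≥ K + 1` contradicts the choice of `Hs N`.
  obtain ⟨K, hK⟩ := (hV.mem _ (linf_select hHs hHC (hνm.mono h𝓖 le_rfl))).2
  obtain ⟨N, hN⟩ := exists_nat_ge (K + 1)
  have hN' : ∀ᵐ ω ∂P, |V (Hs N) ω| ≤ N := by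
    filter_upwards [hK, hU0, hVg', hV.isLocalMap.select h𝓖 hHs hHC hνm] with ω h1 h2 h3 h4
    rw [h4, h3] at h1
    rw [h3]
    have := Nat.find_spec (hex ω) h2 N
    linarith
  exact hbad N (hN'.mono fun ω h => not_lt.2 h)

end UniformBounds

/-! ### Jumps of càdlàg paths and measurability of the next jump time -/

section NextJump

theorem continuousAt_of_notMem_jumpSet {T : ℝ≥0} {y : ℝ≥0 → ℝ} (hy : IsCadlagUpTo T y) {s : ℝ≥0}
    (hs : 0 < s) (hsT : s < T) (hj : s ∉ jumpSet y) : ContinuousAt y s := by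
  rw [continuousAt_iff_continuous_left'_right']
  refine ⟨?_, hy.1 s hsT⟩
  have h1 := tendsto_leftLim_of_tendsto (hy.2 s hs hsT.le)
  have h2 : y s = Function.leftLim y s := by
    simpa [jumpSet, sub_eq_zero] using hj
  rw [ContinuousWithinAt]
  rw [h2]
  exact h1

open TopologicalSpace in
/-- A càdlàg path jumps in `(a, b)` iff it oscillates on a countable dense set. -/
theorem exists_jump_iff {T : ℝ≥0} {y : ℝ≥0 → ℝ} (hy : IsCadlagUpTo T y) {a b : ℝ≥0} (hb : b ≤ T) :
    (∃ s, a < s ∧ s < b ∧ s ∈ jumpSet y) ↔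
      ∃ i j : ℕ, a < denseSeq ℝ≥0 i ∧ denseSeq ℝ≥0 j < b ∧ ∃ k : ℕ, ∀ n : ℕ, ∃ p q : ℕ,
        denseSeq ℝ≥0 p ∈ Set.Icc (denseSeq ℝ≥0 i) (denseSeq ℝ≥0 j) ∧
        denseSeq ℝ≥0 q ∈ Set.Icc (denseSeq ℝ≥0 i) (denseSeq ℝ≥0 j) ∧
        dist (denseSeq ℝ≥0 p) (denseSeq ℝ≥0 q) < 1 / (n + 1 : ℝ) ∧
        1 / (k + 1 : ℝ) < dist (y (denseSeq ℝ≥0 p)) (y (denseSeq ℝ≥0 q)) := by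
  have hd : Dense (Set.range (denseSeq ℝ≥0)) := denseRange_denseSeq ℝ≥0
  have hbtw : ∀ u v : ℝ≥0, u < v → ∃ i, u < denseSeq ℝ≥0 i ∧ denseSeq ℝ≥0 i < v := by
    intro u v huv
    obtain ⟨_, ⟨i, rfl⟩, h⟩ := hd.exists_between huv
    exact ⟨i, h⟩
  constructor
  · rintro ⟨s, has, hsb, hj⟩
    have hs : 0 < s := lt_of_le_of_lt (zero_le) has
    obtain ⟨i, hi1, hi2⟩ := hbtw a s has
    obtain ⟨j, hj1, hj2⟩ := hbtw s b hsb
    have h1 := tendsto_leftLim_of_tendsto (hy.2 s hs (hsb.le.trans hb))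
    set l := Function.leftLim y s
    have hδ : 0 < dist (y s) l := dist_pos.2 (sub_ne_zero.1 hj)
    set δ := dist (y s) l with hδdef
    obtain ⟨k, hk⟩ := exists_nat_one_div_lt (show 0 < δ / 2 by positivity)
    refine ⟨i, j, hi1, hj2, k, fun n => ?_⟩
    have hε : (0 : ℝ) < 1 / (n + 1 : ℝ) / 2 := by positivity
    have e1 : ∀ᶠ u in 𝓝[<] s, dist (y u) l < δ / 4 ∧ dist u s < 1 / (n + 1 : ℝ) / 2 :=
      (h1.eventually (Metric.ball_mem_nhds l (by positivity : 0 < δ / 4))).and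
        (nhdsWithin_le_nhds (Metric.ball_mem_nhds s hε))
    have e2 : ∀ᶠ u in 𝓝[>] s, dist (y u) (y s) < δ / 4 ∧ dist u s < 1 / (n + 1 : ℝ) / 2 :=
      (((hy.1 s (hsb.trans_le hb)).tendsto).eventually
        (Metric.ball_mem_nhds (y s) (by positivity : 0 < δ / 4))).and
        (nhdsWithin_le_nhds (Metric.ball_mem_nhds s hε))
    obtain ⟨c, hc, hcs⟩ := (mem_nhdsLT_iff_exists_Ioo_subset' hi2).1 e1
    obtain ⟨c', hc', hcs'⟩ := (mem_nhdsGT_iff_exists_Ioo_subset' hj1).1 e2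
    obtain ⟨p, hp1, hp2⟩ := hbtw (max c (denseSeq ℝ≥0 i)) s (max_lt hc hi2)
    obtain ⟨q, hq1, hq2⟩ := hbtw s (min c' (denseSeq ℝ≥0 j)) (lt_min hc' hj1)
    have hp3 := hcs ⟨(le_max_left _ _).trans_lt hp1, hp2⟩
    have hq3 := hcs' ⟨hq1, hq2.trans_le (min_le_left _ _)⟩
    simp only [Set.mem_ofPred_eq] at hp3 hq3
    refine ⟨p, q, ⟨((le_max_right _ _).trans_lt hp1).le, (hp2.trans hj1).le⟩,
      ⟨(hi2.trans hq1).le, (hq2.trans_le (min_le_right _ _)).le⟩, ?_, hk.trans ?_⟩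
    · have := dist_triangle_right (denseSeq ℝ≥0 p) (denseSeq ℝ≥0 q) s
      linarith [hp3.2, hq3.2]
    · have h3 := dist_triangle4 (y s) (y (denseSeq ℝ≥0 q)) (y (denseSeq ℝ≥0 p)) l
      rw [dist_comm (y s) (y (denseSeq ℝ≥0 q)), dist_comm (y (denseSeq ℝ≥0 q)) (y (denseSeq ℝ≥0 p))] at h3
      linarith [hp3.1, hq3.1]
  · rintro ⟨i, j, hi, hj, k, h⟩
    by_contra hcon
    push Not at hcon
    -- Without a jump in `(a, b)` the path is continuous on this compact subinterval, and uniform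
    -- continuity excludes oscillation at arbitrarily small distances.
    have hc : ContinuousOn y (Set.Icc (denseSeq ℝ≥0 i) (denseSeq ℝ≥0 j)) := fun s hs =>
      (continuousAt_of_notMem_jumpSet hy ((zero_le).trans_lt (hi.trans_le hs.1))
        ((hs.2.trans_lt hj).trans_le hb)
        (hcon s (hi.trans_le hs.1) (hs.2.trans_lt hj))).continuousWithinAt
    have hu := isCompact_Icc.uniformContinuousOn_of_continuous hc
    rw [Metric.uniformContinuousOn_iff] at hu
    obtain ⟨δ, hδ, hu⟩ := hu (1 / (k + 1 : ℝ)) (by positivity)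
    obtain ⟨n, hn⟩ := exists_nat_one_div_lt hδ
    obtain ⟨p, q, hp, hq, hpq, hlt⟩ := h n
    exact lt_asymm hlt (hu _ hp _ hq (hpq.trans hn))

variable {Ω : Type*} {m : MeasurableSpace Ω} {T : ℝ≥0} {Y : ℝ≥0 → Ω → ℝ}

theorem nextJump_le (σ : Ω → ℝ≥0) (ω : Ω) : nextJump T Y σ ω ≤ T :=
  csInf_le (OrderBot.bddBelow _) (Or.inr rfl)

theorem le_nextJump {σ : Ω → ℝ≥0} {ω : Ω} (h : σ ω ≤ T) : σ ω ≤ nextJump T Y σ ω := by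
  refine le_csInf ⟨T, Or.inr rfl⟩ ?_
  rintro t (⟨h1, _⟩ | rfl)
  · exact h1.le
  · exact h

theorem nextJump_le_of_mem {σ : Ω → ℝ≥0} {ω : Ω} {t : ℝ≥0} (h : σ ω < t)
    (ht : t ∈ jumpSet (fun s => Y s ω)) : nextJump T Y σ ω ≤ t :=
  csInf_le (OrderBot.bddBelow _) (Or.inl ⟨h, ht⟩)

theorem nextJump_lt_iff {σ : Ω → ℝ≥0} {ω : Ω} {t : ℝ≥0} (ht : t ≤ T) :
    nextJump T Y σ ω < t ↔ ∃ s, σ ω < s ∧ s < t ∧ s ∈ jumpSet (fun s => Y s ω) := by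
  unfold nextJump
  rw [csInf_lt_iff (OrderBot.bddBelow _) ⟨T, Or.inr rfl⟩]
  constructor
  · rintro ⟨s, ⟨h1, h2⟩ | rfl, h3⟩
    · exact ⟨s, h1, h3, h2⟩
    · exact absurd h3 (not_lt.2 ht)
  · rintro ⟨s, h1, h2, h3⟩
    exact ⟨s, Or.inl ⟨h1, h3⟩, h2⟩

open TopologicalSpace in
-- Only measurability with respect to the ambient σ-algebra is obtained here; adaptedness comes
-- later, from the jump times and the completeness of the filtration.
theorem measurable_nextJump (hY : ∀ t, StronglyMeasurable (Y t))
    (hc : ∀ ω, IsCadlagUpTo T (fun t => Y t ω)) {σ : Ω → ℝ≥0} (hσ : Measurable σ) :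
    Measurable (nextJump T Y σ) := by
  have hjump : ∀ a b : ℝ≥0, b ≤ T →
      MeasurableSet {ω | ∃ s, a < s ∧ s < b ∧ s ∈ jumpSet (fun s => Y s ω)} := by
    intro a b hb
    have : {ω | ∃ s, a < s ∧ s < b ∧ s ∈ jumpSet (fun s => Y s ω)} = _ :=
      Set.ext fun ω => exists_jump_iff (hc ω) hb
    rw [this]
    refine measurableSet_setOfPred.2 (Measurable.exists fun i => Measurable.exists fun j =>
      measurable_const.and (measurable_const.and (Measurable.exists fun k =>
        Measurable.forall fun n => Measurable.exists fun p => Measurable.exists fun q =>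
        measurable_const.and (measurable_const.and (measurable_const.and ?_)))))
    exact measurableSet_setOfPred.1 (measurableSet_lt measurable_const
      ((hY _).measurable.dist (hY _).measurable))
  refine measurable_of_Iio fun t => ?_
  rcases le_or_gt t T with ht | ht
  · have : nextJump T Y σ ⁻¹' Set.Iio t = ⋃ i : ℕ, {ω | σ ω < denseSeq ℝ≥0 i} ∩
        {ω | ∃ s, denseSeq ℝ≥0 i < s ∧ s < t ∧ s ∈ jumpSet (fun s => Y s ω)} := by
      ext ω
      simp only [Set.mem_preimage, Set.mem_Iio, nextJump_lt_iff ht, Set.mem_iUnion, Set.mem_inter_iff,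
        Set.mem_ofPred_eq]
      constructor
      · rintro ⟨s, h1, h2, h3⟩
        obtain ⟨_, ⟨i, rfl⟩, h⟩ := (denseRange_denseSeq ℝ≥0).exists_between h1
        exact ⟨i, h.1, s, h.2, h2, h3⟩
      · rintro ⟨i, h, s, h1, h2, h3⟩
        exact ⟨s, h.trans h1, h2, h3⟩
    rw [this]
    exact MeasurableSet.iUnion fun i => (measurableSet_lt hσ measurable_const).inter (hjump _ _ ht)
  · convert MeasurableSet.univ
    ext ω
    simpa using (nextJump_le σ ω).trans_lt ht

/-- There is no jump in `(τ_i, σ]`, so both infima run over the same set. -/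
theorem nextJump_eq_jumpTime {σ : Ω → ℝ≥0} {ω : Ω} {i : ℕ} (h1 : jumpTime T Y i ω ≤ σ ω)
    (h2 : σ ω < jumpTime T Y (i + 1) ω) : nextJump T Y σ ω = jumpTime T Y (i + 1) ω := by
  have : {t | σ ω < t ∧ t ∈ jumpSet (fun s => Y s ω)} =
      {t | jumpTime T Y i ω < t ∧ t ∈ jumpSet (fun s => Y s ω)} := by
    ext t
    exact ⟨fun h => ⟨h1.trans_lt h.1, h.2⟩,
      fun h => ⟨h2.trans_le (nextJump_le_of_mem h.1 h.2), h.2⟩⟩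
  unfold nextJump
  rw [this]
  rfl

/-- Otherwise all jump times stay at or below `s < T`. Finiteness of the jump set makes each infimum
a minimum, so they would form a strictly increasing sequence of genuine jumps, contradicting
finiteness. -/
theorem exists_jumpTime_le_lt {ω : Ω}
    (hf : {t | t ≤ T ∧ t ∈ jumpSet (fun s => Y s ω)}.Finite) {s : ℝ≥0} (hs : s < T) :
    ∃ i, jumpTime T Y i ω ≤ s ∧ s < jumpTime T Y (i + 1) ω := by
  by_contra hcon
  push Not at hcon
  have hle : ∀ i, jumpTime T Y i ω ≤ s := by
    intro i
    induction i with
    | zero => exact zero_le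
    | succ i ih => exact hcon i ih
  have hmem : ∀ i, jumpTime T Y i ω < jumpTime T Y (i + 1) ω ∧
      jumpTime T Y (i + 1) ω ∈ {t | t ≤ T ∧ t ∈ jumpSet (fun s => Y s ω)} := by
    intro i
    have hlt : nextJump T Y (jumpTime T Y i) ω < T := (hle (i + 1)).trans_lt hs
    obtain ⟨u, hu1, hu2, hu3⟩ := (nextJump_lt_iff le_rfl).1 hlt
    obtain ⟨v, ⟨hv1, hv2⟩, hvmin⟩ := Set.exists_min_image _ id
      (hf.subset (Set.inter_subset_left (t := Set.Ioi (jumpTime T Y i ω)))) ⟨u, ⟨hu2.le, hu3⟩, hu1⟩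
    have hv : jumpTime T Y (i + 1) ω = v := by
      refine le_antisymm (nextJump_le_of_mem hv2 hv1.2) (le_csInf ⟨T, Or.inr rfl⟩ ?_)
      rintro t (⟨h1, h2⟩ | rfl)
      · rcases le_or_gt t T with ht | ht
        · exact hvmin t ⟨⟨ht, h2⟩, h1⟩
        · exact hv1.1.trans ht.le
      · exact hv1.1
    rw [hv]
    exact ⟨hv2, hv1⟩
  have hmono : StrictMono fun i => jumpTime T Y (i + 1) ω :=
    strictMono_nat_of_lt_succ fun i => (hmem (i + 1)).1
  exact Set.infinite_of_injective_forall_mem hmono.injective (fun i => (hmem i).2) hf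

end NextJump

/-! ### Stopping times with values in `[0, T]` and null events -/

section StoppingTimes

variable {Ω : Type*} {𝓖 : MeasurableSpace Ω} {m : MeasurableSpace Ω} {P : Measure Ω}
  {𝓕 : Filtration ℝ≥0 m} {T : ℝ≥0}

/-- `A` and `B` differ by null events, which `𝓖` contains. This is what allows almost sure relations
between stopping times to be used for measurability. -/
theorem measurableSet_of_ae_iff (hn : nullEvents P ≤ 𝓖) (h𝓖 : 𝓖 ≤ m) {A B : Set Ω}
    (hA : MeasurableSet A) (hB : MeasurableSet[𝓖] B) (h : ∀ᵐ ω ∂P, ω ∈ A ↔ ω ∈ B) :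
    MeasurableSet[𝓖] A := by
  have hB' : MeasurableSet B := h𝓖 _ hB
  have h1 : MeasurableSet[𝓖] (A \ B) := by
    refine hn _ ⟨hA.diff hB', Or.inl ?_⟩
    refine measure_mono_null (fun ω hω => ?_) h
    exact fun h => hω.2 (h.1 hω.1)
  have h2 : MeasurableSet[𝓖] (B \ A) := by
    refine hn _ ⟨hB'.diff hA, Or.inl ?_⟩
    refine measure_mono_null (fun ω hω => ?_) h
    exact fun h => hω.2 (h.2 hω.1)
  have : A = (B \ (B \ A)) ∪ (A \ B) := by
    ext ω; simp only [Set.mem_union, Set.mem_sdiff]; tauto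
  rw [this]
  exact (hB.diff h2).union h1

theorem isStoppingTime_coe_iff {τ : Ω → ℝ≥0} :
    IsStoppingTime 𝓕 (fun ω => ((τ ω : ℝ≥0) : WithTop ℝ≥0)) ↔
      ∀ t, MeasurableSet[𝓕 t] {ω | τ ω ≤ t} := by
  simp only [IsStoppingTime, WithTop.coe_le_coe]

theorem measurableSet_stoppingTime_iff {τ : Ω → ℝ≥0}
    (hτ : IsStoppingTime 𝓕 (fun ω => ((τ ω : ℝ≥0) : WithTop ℝ≥0))) (hT : ∀ ω, τ ω ≤ T)
    {A : Set Ω} : MeasurableSet[hτ.measurableSpace] A ↔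
      ∀ t, MeasurableSet[𝓕 t] (A ∩ {ω | τ ω ≤ t}) := by
  rw [hτ.measurableSet]
  simp only [WithTop.coe_le_coe]
  refine ⟨fun h => h.2, fun h => ⟨?_, h⟩⟩
  have h1 := h T
  rw [show A ∩ {ω | τ ω ≤ T} = A from Set.inter_eq_left.2 fun ω _ => hT ω] at h1
  exact le_iSup (fun t => (𝓕 t : MeasurableSpace Ω)) T _ h1

theorem measurable_of_isStoppingTime_coe {τ : Ω → ℝ≥0}
    (hτ : IsStoppingTime 𝓕 (fun ω => ((τ ω : ℝ≥0) : WithTop ℝ≥0))) : Measurable τ :=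
  measurable_of_Iic fun t => 𝓕.le t _ (isStoppingTime_coe_iff.1 hτ t)

namespace BddStoppingTime

theorem measurableSet_past_iff (σ : BddStoppingTime 𝓕 T) {A : Set Ω} :
    MeasurableSet[σ.past] A ↔ ∀ t, MeasurableSet[𝓕 t] (A ∩ {ω | σ.val ω ≤ t}) :=
  measurableSet_stoppingTime_iff σ.isStoppingTime σ.le

theorem past_le (σ : BddStoppingTime 𝓕 T) : σ.past ≤ m := σ.isStoppingTime.measurableSpace_le

theorem past_le_final (σ : BddStoppingTime 𝓕 T) : σ.past ≤ 𝓕 T :=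
  σ.isStoppingTime.measurableSpace_le_of_le_const fun ω => WithTop.coe_le_coe.2 (σ.le ω)

theorem past_mono {σ ρ : BddStoppingTime 𝓕 T} (h : ∀ ω, σ.val ω ≤ ρ.val ω) : σ.past ≤ ρ.past :=
  σ.isStoppingTime.measurableSpace_mono ρ.isStoppingTime fun ω => WithTop.coe_le_coe.2 (h ω)

theorem measurable (σ : BddStoppingTime 𝓕 T) : Measurable σ.val :=
  measurable_of_isStoppingTime_coe σ.isStoppingTime

theorem measurableSet_le (σ : BddStoppingTime 𝓕 T) (t : ℝ≥0) :
    MeasurableSet[𝓕 t] {ω | σ.val ω ≤ t} := isStoppingTime_coe_iff.1 σ.isStoppingTime t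

theorem nullEvents_le_past (hn : ∀ t, nullEvents P ≤ 𝓕 t) (σ : BddStoppingTime 𝓕 T) :
    nullEvents P ≤ σ.past := fun A hA =>
  σ.measurableSet_past_iff.2 fun t => (hn t A hA).inter (σ.measurableSet_le t)

end BddStoppingTime

end StoppingTimes

/-! ### Traces of σ-algebras, and events known before a random time -/

section Trace

variable {Ω : Type*} {𝓖 : MeasurableSpace Ω} {m : MeasurableSpace Ω} {P : Measure Ω}
  {𝓕 : Filtration ℝ≥0 m}

/-- The events which agree on `E` with some event of `𝓖`. -/
@[reducible] def traceSpace (𝓖 : MeasurableSpace Ω) (E : Set Ω) : MeasurableSpace Ω where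
  MeasurableSet' C := ∃ D, MeasurableSet[𝓖] D ∧ C ∩ E = D ∩ E
  measurableSet_empty := ⟨∅, MeasurableSet.empty, rfl⟩
  measurableSet_compl C := by
    rintro ⟨D, hD, h⟩
    refine ⟨Dᶜ, hD.compl, ?_⟩
    ext ω
    have := Set.ext_iff.1 h ω
    simp only [Set.mem_inter_iff, Set.mem_compl_iff] at this ⊢
    tauto
  measurableSet_iUnion C hC := by
    choose D hD h using hC
    refine ⟨⋃ i, D i, MeasurableSet.iUnion hD, ?_⟩
    rw [Set.iUnion_inter, Set.iUnion_inter]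
    exact Set.iUnion_congr h

theorem le_traceSpace (E : Set Ω) : 𝓖 ≤ traceSpace 𝓖 E := fun C hC => ⟨C, hC, rfl⟩

theorem comap_le_traceSpace {β : Type*} [mβ : MeasurableSpace β] {E : Set Ω} {f g : Ω → β}
    (hg : Measurable[𝓖] g) (h : ∀ ω ∈ E, f ω = g ω) :
    MeasurableSpace.comap f mβ ≤ traceSpace 𝓖 E := by
  rintro _ ⟨U, hU, rfl⟩
  refine ⟨g ⁻¹' U, hg hU, ?_⟩
  ext ω
  simp only [Set.mem_inter_iff, Set.mem_preimage]
  constructor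
  · rintro ⟨h1, h2⟩; exact ⟨h ω h2 ▸ h1, h2⟩
  · rintro ⟨h1, h2⟩; exact ⟨(h ω h2).symm ▸ h1, h2⟩

open TopologicalSpace

theorem exists_denseSeq_btwn {u v : ℝ≥0} (huv : u < v) :
    ∃ i, u < denseSeq ℝ≥0 i ∧ denseSeq ℝ≥0 i < v := by
  obtain ⟨_, ⟨i, rfl⟩, h⟩ := (denseRange_denseSeq ℝ≥0).exists_between huv
  exact ⟨i, h⟩

variable {θ : Ω → ℝ≥0} {B : Set Ω}

/-- Let `D q` be the `𝓖`-event agreeing with `{α ≤ q}` on `{q < θ} ∩ B`. On `B`, the event `{α < x}`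
is the union of the `D q` over `q < x` in the dense sequence. An index with `q ≥ θ` does no harm,
since then `α < θ ≤ q < x` anyway; so measurability of `θ` over `𝓖` is not needed yet. -/
theorem measurableSet_inter_lt_of_trace
    (hn : nullEvents P ≤ 𝓖) (h𝓖 : 𝓖 ≤ m) (hB : MeasurableSet[𝓖] B)
    (htr : ∀ t, 𝓕 t ≤ traceSpace 𝓖 ({ω | t < θ ω} ∩ B)) {α : Ω → ℝ≥0}
    (hα : IsStoppingTime 𝓕 (fun ω => ((α ω : ℝ≥0) : WithTop ℝ≥0)))
    (hlt : ∀ᵐ ω ∂P, ω ∈ B → α ω < θ ω) (x : ℝ≥0) : MeasurableSet[𝓖] (B ∩ {ω | α ω < x}) := by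
  choose D hD hDe using fun i => htr (denseSeq ℝ≥0 i) _
    (isStoppingTime_coe_iff.1 hα (denseSeq ℝ≥0 i))
  refine measurableSet_of_ae_iff hn h𝓖
    (B := B ∩ ⋃ i ∈ {i | denseSeq ℝ≥0 i < x}, D i)
    ((h𝓖 _ hB).inter (measurable_of_isStoppingTime_coe hα measurableSet_Iio))
    (hB.inter (MeasurableSet.biUnion (Set.to_countable _) fun i _ => hD i)) ?_
  filter_upwards [hlt] with ω hω
  simp only [Set.mem_inter_iff, Set.mem_ofPred_eq, Set.mem_iUnion, exists_prop]
  refine and_congr_right fun hωB => ?_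
  have hmem : ∀ i, denseSeq ℝ≥0 i < θ ω → (α ω ≤ denseSeq ℝ≥0 i ↔ ω ∈ D i) := by
    intro i hi
    have := Set.ext_iff.1 (hDe i) ω
    simp only [Set.mem_inter_iff, Set.mem_ofPred_eq, hi, hωB, and_true] at this
    exact this
  constructor
  · intro h
    obtain ⟨i, hi1, hi2⟩ := exists_denseSeq_btwn (lt_min h (hω hωB))
    exact ⟨i, hi2.trans_le (min_le_left _ _), (hmem i (hi2.trans_le (min_le_right _ _))).1 hi1.le⟩
  · rintro ⟨i, hi1, hi2⟩
    rcases lt_or_ge (denseSeq ℝ≥0 i) (θ ω) with h | h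
    · exact ((hmem i h).2 hi2).trans_lt hi1
    · exact (hω hωB).trans_le (h.trans hi1.le)

/-- On `B` the times `α k` lie strictly below `θ` and converge to it, so `x < θ` means that some `α
k` exceeds `x`, and these events are in `𝓖` by the previous lemma. -/
theorem measurableSet_inter_gt_of_trace
    (hn : nullEvents P ≤ 𝓖) (h𝓖 : 𝓖 ≤ m) (hB : MeasurableSet[𝓖] B)
    (htr : ∀ t, 𝓕 t ≤ traceSpace 𝓖 ({ω | t < θ ω} ∩ B)) (hθ : Measurable θ) {α : ℕ → Ω → ℝ≥0}
    (hα : ∀ k, IsStoppingTime 𝓕 (fun ω => ((α k ω : ℝ≥0) : WithTop ℝ≥0)))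
    (hlt : ∀ᵐ ω ∂P, ω ∈ B → ∀ k, α k ω < θ ω)
    (hlim : ∀ᵐ ω ∂P, ω ∈ B → Tendsto (fun k => α k ω) atTop (𝓝 (θ ω))) (x : ℝ≥0) :
    MeasurableSet[𝓖] (B ∩ {ω | x < θ ω}) := by
  refine measurableSet_of_ae_iff hn h𝓖
    (B := ⋃ k, ⋃ i ∈ {i | x < denseSeq ℝ≥0 i}, B \ (B ∩ {ω | α k ω < denseSeq ℝ≥0 i}))
    ((h𝓖 _ hB).inter (hθ measurableSet_Ioi))
    (MeasurableSet.iUnion fun k => MeasurableSet.biUnion (Set.to_countable _) fun i _ =>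
      hB.diff (measurableSet_inter_lt_of_trace hn h𝓖 hB htr (hα k)
        (hlt.mono fun ω h hω => h hω k) _)) ?_
  filter_upwards [hlt, hlim] with ω h1 h2
  simp only [Set.mem_inter_iff, Set.mem_ofPred_eq, Set.mem_iUnion, exists_prop, Set.mem_sdiff,
    not_and, not_lt]
  constructor
  · rintro ⟨hωB, hx⟩
    obtain ⟨k, hk⟩ := ((h2 hωB).eventually (lt_mem_nhds hx)).exists
    obtain ⟨i, hi1, hi2⟩ := exists_denseSeq_btwn hk
    exact ⟨k, i, hi1, hωB, fun _ => hi2.le⟩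
  · rintro ⟨k, i, hi, hωB, h⟩
    exact ⟨hωB, (hi.trans_le (h hωB)).trans (h1 hωB k)⟩

/-- On `B` there is a dense time `q` between `ρ` and `θ`. By `q` the event `A` has been observed,
and before `θ` this observation is made with an event of `𝓖`. -/
theorem measurableSet_inter_of_trace
    (hn : nullEvents P ≤ 𝓖) (h𝓖 : 𝓖 ≤ m)
    (htr : ∀ t, 𝓕 t ≤ traceSpace 𝓖 ({ω | t < θ ω} ∩ B))
    (hθ : ∀ x, MeasurableSet[𝓖] (B ∩ {ω | x < θ ω})) {ρ : Ω → ℝ≥0}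
    (hlt : ∀ᵐ ω ∂P, ω ∈ B → ρ ω < θ ω) {A : Set Ω} (hAB : MeasurableSet (A ∩ B))
    (hA : ∀ t, MeasurableSet[𝓕 t] (A ∩ {ω | ρ ω ≤ t})) : MeasurableSet[𝓖] (A ∩ B) := by
  choose D hD hDe using fun i => htr (denseSeq ℝ≥0 i) _ (hA (denseSeq ℝ≥0 i))
  refine measurableSet_of_ae_iff hn h𝓖
    (B := ⋃ i, D i ∩ (B ∩ {ω | denseSeq ℝ≥0 i < θ ω})) hAB
    (MeasurableSet.iUnion fun i => (hD i).inter (hθ _)) ?_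
  filter_upwards [hlt] with ω hω
  simp only [Set.mem_inter_iff, Set.mem_ofPred_eq, Set.mem_iUnion]
  have hmem : ∀ i, ω ∈ B → denseSeq ℝ≥0 i < θ ω → ((ω ∈ A ∧ ρ ω ≤ denseSeq ℝ≥0 i) ↔ ω ∈ D i) := by
    intro i hωB hi
    have := Set.ext_iff.1 (hDe i) ω
    simp only [Set.mem_inter_iff, Set.mem_ofPred_eq, hi, hωB, and_true] at this
    exact this
  constructor
  · rintro ⟨hωA, hωB⟩
    obtain ⟨i, hi1, hi2⟩ := exists_denseSeq_btwn (hω hωB)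
    exact ⟨i, (hmem i hωB hi2).1 ⟨hωA, hi1.le⟩, hωB, hi2⟩
  · rintro ⟨i, h1, hωB, hi⟩
    exact ⟨((hmem i hωB hi).2 h1).1, hωB⟩

end Trace

/-! ### Announcing the first jump after `σ` -/

section Announcing

variable {Ω : Type*} {𝓖 : MeasurableSpace Ω} {m : MeasurableSpace Ω} {P : Measure Ω}
  {𝓕 𝓕Y : Filtration ℝ≥0 m} {T : ℝ≥0} {Y : ℝ≥0 → Ω → ℝ}

/-- The event that `σ` lies between the `i`-th jump time (included) and the next one. -/
def jumpInterval (T : ℝ≥0) (Y : ℝ≥0 → Ω → ℝ) (σ : Ω → ℝ≥0) (i : ℕ) : Set Ω :=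
  {ω | jumpTime T Y i ω ≤ σ ω ∧ σ ω < jumpTime T Y (i + 1) ω}

theorem jumpTime_le (i : ℕ) (ω : Ω) : jumpTime T Y i ω ≤ T := by
  cases i with
  | zero => exact zero_le
  | succ i => exact nextJump_le _ _

theorem IsInsuranceProcess.isStoppingTime_jumpTime (hins : IsInsuranceProcess P T 𝓕 𝓕Y Y) (i : ℕ) :
    IsStoppingTime 𝓕 (fun ω => ((jumpTime T Y i ω : ℝ≥0) : WithTop ℝ≥0)) := by
  cases i with
  | zero => exact isStoppingTime_const 𝓕 0
  | succ i => exact (hins.predictable i).1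

theorem IsInsuranceProcess.measurableSet_jumpInterval (hins : IsInsuranceProcess P T 𝓕 𝓕Y Y)
    (σ : BddStoppingTime 𝓕 T) (i : ℕ) : MeasurableSet[σ.past] (jumpInterval T Y σ.val i) := by
  have h1 := (hins.isStoppingTime_jumpTime i).measurableSet_stopping_time_le σ.isStoppingTime
  have h2 := (hins.isStoppingTime_jumpTime (i + 1)).measurableSet_stopping_time_le σ.isStoppingTime
  have h3 := h1.inter h2.compl
  convert h3 using 1
  ext ω
  exact and_congr WithTop.coe_le_coe.symm (not_le.symm.trans (not_congr WithTop.coe_le_coe.symm))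

theorem IsInsuranceProcess.ae_mem_jumpInterval (hins : IsInsuranceProcess P T 𝓕 𝓕Y Y)
    (σ : BddStoppingTime 𝓕 T) :
    ∀ᵐ ω ∂P, (∃ i, ω ∈ jumpInterval T Y σ.val i) ∨ σ.val ω = T := by
  filter_upwards [hins.finite_jumps] with ω hω
  rcases (σ.le ω).lt_or_eq with h | h
  · exact Or.inl (exists_jumpTime_le_lt hω h)
  · exact Or.inr h

theorem nextJump_eq_of_mem {σ : Ω → ℝ≥0} {ω : Ω} {i : ℕ} (h : ω ∈ jumpInterval T Y σ i) :
    nextJump T Y σ ω = jumpTime T Y (i + 1) ω := nextJump_eq_jumpTime h.1 h.2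

/-- Up to null events `Ω` is covered by the jump intervals, which belong to `𝓕_σ` and on which the
next jump is the stopping time `τ_{i+1}`, and by `{σ = T}`, which plays no role for `t < T`. -/
theorem IsInsuranceProcess.isStoppingTime_nextJump (hins : IsInsuranceProcess P T 𝓕 𝓕Y Y)
    (hn : ∀ t, nullEvents P ≤ 𝓕 t) (hY : ∀ t, StronglyMeasurable (Y t))
    (σ : BddStoppingTime 𝓕 T) :
    IsStoppingTime 𝓕 (fun ω => ((nextJump T Y σ.val ω : ℝ≥0) : WithTop ℝ≥0)) := by
  rw [isStoppingTime_coe_iff]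
  intro t
  rcases le_or_gt T t with ht | ht
  · convert MeasurableSet.univ
    ext ω
    simpa using (nextJump_le _ _).trans ht
  · refine measurableSet_of_ae_iff (hn t) (𝓕.le t)
      (B := ⋃ i, jumpInterval T Y σ.val i ∩ {ω | σ.val ω ≤ t} ∩ {ω | jumpTime T Y (i + 1) ω ≤ t})
      (measurable_nextJump hY hins.cadlag σ.measurable measurableSet_Iic)
      (MeasurableSet.iUnion fun i =>
        (σ.measurableSet_past_iff.1 (hins.measurableSet_jumpInterval σ i) t).inter
          (isStoppingTime_coe_iff.1 (hins.isStoppingTime_jumpTime (i + 1)) t)) ?_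
    filter_upwards [hins.ae_mem_jumpInterval σ] with ω hω
    simp only [Set.mem_inter_iff, Set.mem_ofPred_eq, Set.mem_iUnion]
    constructor
    · intro h
      have hσt := (le_nextJump (Y := Y) (σ.le ω)).trans h
      rcases hω with ⟨i, hi⟩ | hω
      · exact ⟨i, ⟨hi, hσt⟩, nextJump_eq_of_mem hi ▸ h⟩
      · exact absurd (hσt.trans_lt ht) (by simp [hω])
    · rintro ⟨i, ⟨hi, _⟩, h⟩
      rwa [nextJump_eq_of_mem hi]

/-- The stopping times `ρ k` announce `τ`, the time of the first jump after `σ`. -/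
structure Announces (P : Measure Ω) (Y : ℝ≥0 → Ω → ℝ) (σ τ : BddStoppingTime 𝓕 T)
    (ρ : ℕ → BddStoppingTime 𝓕 T) : Prop where
  val_eq : τ.val = nextJump T Y σ.val
  mono : ∀ ω, Monotone fun k => (ρ k).val ω
  ge : ∀ k ω, σ.val ω ≤ (ρ k).val ω
  le : ∀ k ω, (ρ k).val ω ≤ τ.val ω
  tendsto : ∀ᵐ ω ∂P, Tendsto (fun k => (ρ k).val ω) atTop (𝓝 (τ.val ω))
  lt : ∀ᵐ ω ∂P, ∀ i, ω ∈ jumpInterval T Y σ.val i → ∀ k, (ρ k).val ω < jumpTime T Y (i + 1) ω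
  eq : ∀ᵐ ω ∂P, (∀ i, ω ∉ jumpInterval T Y σ.val i) → ∀ k, (ρ k).val ω = σ.val ω

theorem IsInsuranceProcess.exists_announces (hins : IsInsuranceProcess P T 𝓕 𝓕Y Y)
    (σ τ : BddStoppingTime 𝓕 T) (hτ : τ.val = nextJump T Y σ.val) :
    ∃ ρ, Announces P Y σ τ ρ := by
  classical
  choose α hα hαP using fun i => (hins.predictable i).2
  have hστ : ∀ ω, σ.val ω ≤ τ.val ω := fun ω => by rw [hτ]; exact le_nextJump (σ.le ω)
  set B := jumpInterval T Y σ.val with hBdef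
  have hB : ∀ i, MeasurableSet[σ.past] (B i) := hins.measurableSet_jumpInterval σ
  have hex : ∀ ω, ∃ i, (ω ∈ B i ∨ ∀ j, ω ∉ B j) := by
    intro ω
    by_cases h : ∃ i, ω ∈ B i
    · obtain ⟨i, hi⟩ := h; exact ⟨i, Or.inl hi⟩
    · exact ⟨0, Or.inr (not_exists.1 h)⟩
  set ι : Ω → ℕ := fun ω => Nat.find (hex ω) with hι
  have hιm : Measurable[σ.past] ι := by
    refine @measurable_find _ σ.past _ _ hex fun n => ?_
    have : {ω | ω ∈ B n ∨ ∀ j, ω ∉ B j} = B n ∪ ⋂ j, (B j)ᶜ := by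
      ext ω; simp
    rw [this]
    exact (hB n).union (MeasurableSet.iInter fun j => (hB j).compl)
  have hιB : ∀ ω i, ω ∈ B i → ω ∈ B (ι ω) := by
    intro ω i hi
    exact (Nat.find_spec (hex ω)).resolve_right fun h => h i hi
  -- The given announcing times increase only almost surely; running maxima increase for every `ω`,
  -- as a filtration of pasts requires.
  set β : ℕ → ℕ → Ω → ℝ≥0 := fun i k ω => (Finset.range (k + 1)).sup fun j => α i j ω with hβ
  have hβm : ∀ i k t, MeasurableSet[𝓕 t] {ω | β i k ω ≤ t} := by
    intro i k t
    have : {ω | β i k ω ≤ t} = ⋂ j ∈ Finset.range (k + 1), {ω | α i j ω ≤ t} := by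
      ext ω
      simp only [hβ, Finset.sup_le_iff, Set.mem_ofPred_eq, Set.mem_iInter]
    rw [this]
    exact Finset.measurableSet_biInter _ fun j _ => isStoppingTime_coe_iff.1 (hα i j) t
  -- The announcing sequence of the jump selected by `ι`, raised to at least `σ` and capped by `τ`.
  -- The selection is `𝓕_σ`-measurable and only matters once `σ` has passed.
  have hst : ∀ k, IsStoppingTime 𝓕 (fun ω =>
      ((min (max (σ.val ω) (β (ι ω) k ω)) (τ.val ω) : ℝ≥0) : WithTop ℝ≥0)) := by
    intro k
    rw [isStoppingTime_coe_iff]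
    intro t
    have : {ω | min (max (σ.val ω) (β (ι ω) k ω)) (τ.val ω) ≤ t} =
        {ω | τ.val ω ≤ t} ∪ ⋃ i, ((ι ⁻¹' {i} ∩ {ω | σ.val ω ≤ t}) ∩ {ω | β i k ω ≤ t}) := by
      ext ω
      simp only [Set.mem_ofPred_eq, min_le_iff, max_le_iff, Set.mem_union, Set.mem_iUnion,
        Set.mem_inter_iff, Set.mem_preimage, Set.mem_singleton_iff]
      constructor
      · rintro (⟨h1, h2⟩ | h)
        · exact Or.inr ⟨_, ⟨rfl, h1⟩, h2⟩
        · exact Or.inl h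
      · rintro (h | ⟨i, ⟨rfl, h1⟩, h2⟩)
        · exact Or.inr h
        · exact Or.inl ⟨h1, h2⟩
    rw [this]
    exact (τ.measurableSet_le t).union (MeasurableSet.iUnion fun i =>
      (σ.measurableSet_past_iff.1 (hιm (measurableSet_singleton i)) t).inter (hβm i k t))
  have hae : ∀ᵐ ω ∂P, ∀ i, ω ∈ B i → Tendsto (fun k => β (ι ω) k ω) atTop (𝓝 (τ.val ω)) ∧
      ∀ k, β (ι ω) k ω < τ.val ω := by
    filter_upwards [ae_all_iff.2 hαP] with ω hω i hi
    obtain ⟨h1, h2, h3⟩ := hω (ι ω)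
    have h4 := hιB ω i hi
    have h5 : τ.val ω = jumpTime T Y (ι ω + 1) ω := by rw [hτ]; exact nextJump_eq_of_mem h4
    have h6 : ∀ k, β (ι ω) k ω = α (ι ω) k ω := by
      intro k
      refine le_antisymm (Finset.sup_le fun j hj => h1 (Finset.mem_range_succ_iff.1 hj)) ?_
      exact Finset.le_sup (f := fun j => α (ι ω) j ω) (Finset.self_mem_range_succ k)
    rw [h5]
    simp only [h6]
    exact ⟨h2, h3 (zero_le.trans_lt h4.2)⟩
  refine ⟨fun k => ⟨_, hst k, fun ω => (min_le_right _ _).trans (τ.le ω)⟩, hτ, ?_, ?_, ?_, ?_,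
    ?_, ?_⟩
  · intro ω k l hkl
    exact min_le_min_right _ (max_le_max_left _
      (Finset.sup_mono (Finset.range_mono (Nat.succ_le_succ hkl))))
  · exact fun k ω => le_min (le_max_left _ _) (hστ ω)
  · exact fun k ω => min_le_right _ _
  · filter_upwards [hae, hins.ae_mem_jumpInterval σ] with ω h1 h2
    rcases h2 with ⟨i, hi⟩ | h2
    · have h3 := (tendsto_const_nhds (x := σ.val ω)).max (h1 i hi).1
      have h4 := h3.min (tendsto_const_nhds (x := τ.val ω))
      simpa [hστ ω] using h4
    · have h3 : τ.val ω = T := le_antisymm (τ.le ω) (h2.symm.le.trans (hστ ω))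
      refine tendsto_const_nhds.congr fun k => ?_
      simp [h2, h3]
  · filter_upwards [hae] with ω h1 i hi k
    have h5 : τ.val ω = jumpTime T Y (i + 1) ω := by rw [hτ]; exact nextJump_eq_of_mem hi
    rw [← h5]
    refine min_lt_iff.2 (Or.inl (max_lt ?_ ((h1 i hi).2 k)))
    rw [h5]; exact hi.2
  · filter_upwards [hins.ae_mem_jumpInterval σ] with ω h2 h k
    have h2 := h2.resolve_left (not_exists.2 h)
    have h3 : τ.val ω = T := le_antisymm (τ.le ω) (h2.symm.le.trans (hστ ω))
    simp [h2, h3]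

/-- Before the next jump after `σ` only events of `𝓖` are observed, if `𝓖` contains the past of
`σ` and the traces of the information on the jump intervals. -/
theorem Announces.past_le_of_trace (hins : IsInsuranceProcess P T 𝓕 𝓕Y Y)
    (hn : ∀ t, nullEvents P ≤ 𝓕 t) {σ τ : BddStoppingTime 𝓕 T} {ρ : ℕ → BddStoppingTime 𝓕 T}
    (hρ : Announces P Y σ τ ρ) (h𝓖 : 𝓖 ≤ m) (hσ𝓖 : σ.past ≤ 𝓖)
    (htr : ∀ i t, 𝓕 t ≤ traceSpace 𝓖
      ({ω | t < jumpTime T Y (i + 1) ω} ∩ jumpInterval T Y σ.val i)) (k : ℕ) :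
    (ρ k).past ≤ 𝓖 := by
  intro A hA
  have hn𝓖 : nullEvents P ≤ 𝓖 := (σ.nullEvents_le_past hn).trans hσ𝓖
  have hAm : MeasurableSet A := (ρ k).past_le _ hA
  have hA' := (ρ k).measurableSet_past_iff.1 hA
  set B := jumpInterval T Y σ.val with hBdef
  have hB : ∀ i, MeasurableSet[σ.past] (B i) := hins.measurableSet_jumpInterval σ
  -- Off the jump intervals `ρ k = σ` almost surely, so there the past of `ρ k` is that of `σ`.
  set R : Set Ω := (⋃ i, B i)ᶜ with hR
  have hRm : MeasurableSet[σ.past] R := (MeasurableSet.iUnion hB).compl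
  have h1 : ∀ i, MeasurableSet[𝓖] (A ∩ B i) := by
    intro i
    have hgt : ∀ x, MeasurableSet[𝓖] (B i ∩ {ω | x < jumpTime T Y (i + 1) ω}) := by
      refine measurableSet_inter_gt_of_trace hn𝓖 h𝓖 (hσ𝓖 _ (hB i)) (htr i)
        (measurable_of_isStoppingTime_coe (hins.isStoppingTime_jumpTime (i + 1)))
        (fun l => (ρ l).isStoppingTime) ?_ ?_
      · filter_upwards [hρ.lt] with ω h hω l using h i hω l
      · filter_upwards [hρ.tendsto] with ω h hω
        rw [hρ.val_eq, nextJump_eq_of_mem hω] at h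
        exact h
    refine measurableSet_inter_of_trace hn𝓖 h𝓖 (htr i) hgt ?_
      (hAm.inter (σ.past_le _ (hB i))) hA'
    filter_upwards [hρ.lt] with ω h hω using h i hω k
  have h2 : MeasurableSet[σ.past] (A ∩ R) := by
    rw [σ.measurableSet_past_iff]
    intro t
    refine measurableSet_of_ae_iff (hn t) (𝓕.le t)
      (B := (A ∩ {ω | (ρ k).val ω ≤ t}) ∩ (R ∩ {ω | σ.val ω ≤ t}))
      ((hAm.inter (σ.past_le _ hRm)).inter (𝓕.le t _ (σ.measurableSet_le t)))
      ((hA' t).inter (σ.measurableSet_past_iff.1 hRm t)) ?_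
    filter_upwards [hρ.eq] with ω hω
    simp only [Set.mem_inter_iff, Set.mem_ofPred_eq]
    constructor
    · rintro ⟨⟨a1, a2⟩, a3⟩
      have : ∀ i, ω ∉ B i := by simpa [hR] using a2
      exact ⟨⟨a1, (hω this k).symm ▸ a3⟩, a2, a3⟩
    · rintro ⟨⟨a1, a2⟩, a3, a4⟩
      exact ⟨⟨a1, a3⟩, a4⟩
  have h3 : A = (⋃ i, A ∩ B i) ∪ (A ∩ R) := by
    rw [← Set.inter_iUnion, ← Set.inter_union_distrib_left, hR, Set.union_compl_self,
      Set.inter_univ]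
  rw [h3]
  exact (MeasurableSet.iUnion h1).union (hσ𝓖 _ h2)

end Announcing

/-! ### The information before the next jump is stock information -/

section StoppedInformation

variable {Ω : Type*} {𝓖 : MeasurableSpace Ω} {m : MeasurableSpace Ω} {P : Measure Ω}
  {𝓕 𝓕Y 𝓕S : Filtration ℝ≥0 m} {T : ℝ≥0} {Y : ℝ≥0 → Ω → ℝ} {n : ℕ} {S : ℝ≥0 → Ω → Fin n → ℝ}
  {hS : ∀ t, StronglyMeasurable (S t)} {hY : ∀ t, StronglyMeasurable (Y t)}

theorem nullEvents_le_generatedFiltration {β : Type*} [TopologicalSpace β]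
    [TopologicalSpace.MetrizableSpace β] [MeasurableSpace β] [BorelSpace β] {X : ℝ≥0 → Ω → β}
    {hX : ∀ t, StronglyMeasurable (X t)} (t : ℝ≥0) :
    nullEvents P ≤ generatedFiltration P X hX t :=
  le_sup_right (a := (Filtration.natural X hX t : MeasurableSpace Ω))

theorem comap_le_generatedFiltration {β : Type*} [TopologicalSpace β]
    [TopologicalSpace.MetrizableSpace β] [MeasurableSpace β] [BorelSpace β] {X : ℝ≥0 → Ω → β}
    {hX : ∀ t, StronglyMeasurable (X t)} {s t : ℝ≥0} (hst : s ≤ t) :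
    MeasurableSpace.comap (X s) inferInstance ≤ generatedFiltration P X hX t :=
  (le_iSup₂_of_le (f := fun j (_ : j ≤ t) => MeasurableSpace.comap (X j) inferInstance) s hst
    le_rfl).trans le_sup_left

theorem generatedFiltration_le {β : Type*} [TopologicalSpace β]
    [TopologicalSpace.MetrizableSpace β] [MeasurableSpace β] [BorelSpace β] {X : ℝ≥0 → Ω → β}
    {hX : ∀ t, StronglyMeasurable (X t)} {t : ℝ≥0} (hn : nullEvents P ≤ 𝓖)
    (h : ∀ s ≤ t, MeasurableSpace.comap (X s) inferInstance ≤ 𝓖) :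
    generatedFiltration P X hX t ≤ 𝓖 :=
  sup_le (iSup₂_le h) hn

/-- Between the jumps of the insurance process, its own information is contained in the past. -/
theorem IsInsuranceProcess.comap_le_traceSpace (hins : IsInsuranceProcess P T 𝓕 𝓕Y Y)
    (hYF : 𝓕Y ≤ 𝓕) {σ : BddStoppingTime 𝓕 T} (hσ : σ.past ≤ 𝓖) (i : ℕ) {s t : ℝ≥0}
    (hst : s ≤ t) : MeasurableSpace.comap (Y s) inferInstance ≤ traceSpace 𝓖
      ({ω | t < jumpTime T Y (i + 1) ω} ∩ jumpInterval T Y σ.val i) := by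
  -- `Y s` agrees before `τ_{i+1}` with the process `Z` frozen at the left limit there. The absence
  -- of news puts `Z` in the past of `τ_i`, and on `{τ_i ≤ σ}` this past is contained in that of
  -- `σ`.
  rintro _ ⟨U, hU, rfl⟩
  obtain ⟨h, hle⟩ := hins.no_news i
  set Z : Ω → ℝ := fun ω => if s < jumpTime T Y (i + 1) ω then Y s ω else
    Function.leftLim (fun s => Y s ω) (jumpTime T Y (i + 1) ω) with hZ
  have h1 : MeasurableSet[h.measurableSpace] (Z ⁻¹' U) :=
    hle _ (le_iSup (fun t : ℝ≥0 => MeasurableSpace.comap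
      (fun ω => if t < jumpTime T Y (i + 1) ω then Y t ω else
        Function.leftLim (fun s => Y s ω) (jumpTime T Y (i + 1) ω)) inferInstance) s _ ⟨U, hU, rfl⟩)
  have hi := hins.isStoppingTime_jumpTime i
  have h2 : MeasurableSet[hi.measurableSpace] (Z ⁻¹' U) := by
    rw [measurableSet_stoppingTime_iff h (jumpTime_le i)] at h1
    rw [measurableSet_stoppingTime_iff hi (jumpTime_le i)]
    exact fun t => hYF t _ (h1 t)
  have h3 : MeasurableSet[σ.past] (Z ⁻¹' U ∩ {ω | jumpTime T Y i ω ≤ σ.val ω}) := by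
    have h4 := hi.measurableSet_inter_le σ.isStoppingTime _ h2
    rw [IsStoppingTime.measurableSet_min_iff hi σ.isStoppingTime] at h4
    have e : Z ⁻¹' U ∩ {ω | jumpTime T Y i ω ≤ σ.val ω} = Z ⁻¹' U ∩
        {ω | ((jumpTime T Y i ω : ℝ≥0) : WithTop ℝ≥0) ≤ ((σ.val ω : ℝ≥0) : WithTop ℝ≥0)} := by
      simp only [WithTop.coe_le_coe]
    rw [e]
    exact h4.2
  refine ⟨Z ⁻¹' U ∩ {ω | jumpTime T Y i ω ≤ σ.val ω}, hσ _ h3, ?_⟩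
  ext ω
  simp only [Set.mem_inter_iff, Set.mem_preimage, Set.mem_ofPred_eq]
  constructor
  · rintro ⟨a1, a2, a3⟩
    exact ⟨⟨by simpa [hZ, hst.trans_lt a2] using a1, a3.1⟩, a2, a3⟩
  · rintro ⟨⟨a1, _⟩, a2, a3⟩
    exact ⟨by simpa [hZ, hst.trans_lt a2] using a1, a2, a3⟩

/-- The insurance part of the filtration and the null events have traces in `𝓖` already, so only the
stocks remain to be checked. It is applied twice, with `𝓖` built from `𝓕S_T` and from the stopped
stocks. -/
theorem Announces.past_le_of_stock (h𝓕 : 𝓕 = generatedFiltration P S hS ⊔ 𝓕Y)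
    (h𝓕Y : 𝓕Y = generatedFiltration P Y hY)
    (hins : IsInsuranceProcess P T 𝓕 𝓕Y Y) {σ τ : BddStoppingTime 𝓕 T}
    {ρ : ℕ → BddStoppingTime 𝓕 T} (hρ : Announces P Y σ τ ρ) (h𝓖 : 𝓖 ≤ m) (hσ𝓖 : σ.past ≤ 𝓖)
    (htr : ∀ i s t, s ≤ t → MeasurableSpace.comap (S s) inferInstance ≤ traceSpace 𝓖
      ({ω | t < jumpTime T Y (i + 1) ω} ∩ jumpInterval T Y σ.val i)) (k : ℕ) :
    (ρ k).past ≤ 𝓖 := by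
  have hYF : 𝓕Y ≤ 𝓕 := h𝓕 ▸ le_sup_right
  have hn : ∀ t, nullEvents P ≤ 𝓕 t := by
    subst h𝓕Y
    exact fun t => (nullEvents_le_generatedFiltration t).trans (hYF t)
  refine hρ.past_le_of_trace hins hn h𝓖 hσ𝓖 (fun i t => ?_) k
  have hn' : nullEvents P ≤ traceSpace 𝓖
      ({ω | t < jumpTime T Y (i + 1) ω} ∩ jumpInterval T Y σ.val i) :=
    ((σ.nullEvents_le_past hn).trans hσ𝓖).trans (le_traceSpace _)
  have h1 : 𝓕 t ≤ generatedFiltration P S hS t ⊔ generatedFiltration P Y hY t := by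
    rw [h𝓕, h𝓕Y]; exact le_rfl
  refine h1.trans (sup_le (generatedFiltration_le hn' fun s hs => htr i s t hs)
    (generatedFiltration_le hn' fun s hs => ?_))
  exact hins.comap_le_traceSpace hYF hσ𝓖 i hs

theorem Announces.past_le_stock_sup_past (h𝓕 : 𝓕 = generatedFiltration P S hS ⊔ 𝓕Y)
    (h𝓕Y : 𝓕Y = generatedFiltration P Y hY)
    (hins : IsInsuranceProcess P T 𝓕 𝓕Y Y) {σ τ : BddStoppingTime 𝓕 T}
    {ρ : ℕ → BddStoppingTime 𝓕 T} (hρ : Announces P Y σ τ ρ) (k : ℕ) :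
    (ρ k).past ≤ generatedFiltration P S hS T ⊔ σ.past := by
  refine hρ.past_le_of_stock h𝓕 h𝓕Y hins (sup_le (Filtration.le _ _) σ.past_le) le_sup_right
    (fun i s t hst => ?_) k
  rcases lt_or_ge t T with ht | ht
  · exact ((comap_le_generatedFiltration (hst.trans ht.le)).trans le_sup_left).trans
      (le_traceSpace _)
  -- Jump times do not exceed `T`, so from `T` on the trace event is empty and every event has a
  -- trivial trace.
  · have : {ω | t < jumpTime T Y (i + 1) ω} ∩ jumpInterval T Y σ.val i = ∅ := by
      ext ω
      simp [((jumpTime_le (i + 1) ω).trans ht).not_gt]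
    intro C _
    exact ⟨∅, @MeasurableSet.empty _ (_), by simp [this]⟩

/-- Progressive measurability requires continuous paths, and continuity is known only on `[0, T]`;
hence the process is first frozen at `T`, which does not change its value at times bounded by `T`.
-/
theorem measurable_stopped (h𝓕 : generatedFiltration P S hS ≤ 𝓕)
    (hScont : ∀ ω, ContinuousOn (fun t => S t ω) (Set.Iic T)) (α : BddStoppingTime 𝓕 T) (t : ℝ≥0) :
    Measurable[α.past] (fun ω => S (min t (α.val ω)) ω) := by
  have hc : ∀ ω, Continuous fun s => S (min s T) ω := fun ω =>
    (hScont ω).comp_continuous (continuous_id.min continuous_const) fun s => Set.mem_Iic.2 (min_le_right _ _)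
  have had : StronglyAdapted 𝓕 (fun s ω => S (min s T) ω) := by
    intro s
    have h1 : Measurable[𝓕 s] (S (min s T)) := by
      rw [measurable_iff_comap_le]
      exact (comap_le_generatedFiltration (min_le_left _ _)).trans (h𝓕 s)
    exact h1.stronglyMeasurable
  have hp := had.isStronglyProgressive_of_continuous hc
  have hst := α.isStoppingTime.min_const t
  have h1 := measurable_stoppedValue hp hst
  have h2 := h1.mono (hst.measurableSpace_mono α.isStoppingTime fun ω => min_le_left _ _) le_rfl
  convert h2 using 1
  ext1 ω
  have h3 : min ((α.val ω : ℝ≥0) : WithTop ℝ≥0) (t : WithTop ℝ≥0) =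
    ((min (α.val ω) t : ℝ≥0) : WithTop ℝ≥0) := (WithTop.coe_min _ _).symm
  simp only [stoppedValue]
  rw [h3]
  change _ = S (min (min (α.val ω) t) T) ω
  rw [min_comm t, min_eq_left ((min_le_left _ _).trans (α.le ω))]

theorem Announces.past_le_stoppedInfo (h𝓕 : 𝓕 = generatedFiltration P S hS ⊔ 𝓕Y)
    (h𝓕Y : 𝓕Y = generatedFiltration P Y hY)
    (hScont : ∀ ω, ContinuousOn (fun t => S t ω) (Set.Iic T))
    (hins : IsInsuranceProcess P T 𝓕 𝓕Y Y) {σ τ : BddStoppingTime 𝓕 T}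
    {ρ : ℕ → BddStoppingTime 𝓕 T} (hρ : Announces P Y σ τ ρ) (k : ℕ) :
    (ρ k).past ≤ stoppedInfo S τ.val ⊔ σ.past := by
  have h1 : stoppedInfo S τ.val ≤ m := iSup_le fun t => by
    rw [← measurable_iff_comap_le]
    exact (measurable_stopped (h𝓕 ▸ le_sup_left) hScont τ t).mono τ.past_le le_rfl
  refine hρ.past_le_of_stock h𝓕 h𝓕Y hins (sup_le h1 σ.past_le) le_sup_right
    (fun i s t hst => ?_) k
  refine MarketEval.comap_le_traceSpace (g := fun ω => S (min s (τ.val ω)) ω) ?_ fun ω hω => ?_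
  · rw [measurable_iff_comap_le]
    exact (le_iSup (fun t : ℝ≥0 => MeasurableSpace.comap (fun ω => S (min t (τ.val ω)) ω)
      inferInstance) s).trans le_sup_left
  · have h2 : τ.val ω = jumpTime T Y (i + 1) ω := by
      rw [hρ.val_eq]; exact nextJump_eq_of_mem hω.2
    have h3 : s ≤ τ.val ω := by rw [h2]; exact (hst.trans_lt hω.1).le
    rw [min_eq_left h3]

/-- The limit is compared with `limUnder`, which is `𝓖`-measurable whether or not the sequence
converges; the exceptional null set belongs to `𝓖`. -/
theorem measurable_of_ae_tendsto {β : Type*} [TopologicalSpace β]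
    [TopologicalSpace.IsCompletelyMetrizableSpace β] [SecondCountableTopology β] [MeasurableSpace β]
    [BorelSpace β] [Nonempty β] (hn : nullEvents P ≤ 𝓖) (h𝓖 : 𝓖 ≤ m) {f : ℕ → Ω → β} {g : Ω → β}
    (hf : ∀ k, Measurable[𝓖] (f k)) (hg : Measurable g)
    (h : ∀ᵐ ω ∂P, Tendsto (fun k => f k ω) atTop (𝓝 (g ω))) : Measurable[𝓖] g := by
  have h1 : StronglyMeasurable[𝓖] fun ω => limUnder atTop fun k => f k ω :=
    @StronglyMeasurable.limUnder _ _ _ 𝓖 _ _ _ _ _ _ _ fun k => (hf k).stronglyMeasurable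
  intro U hU
  refine measurableSet_of_ae_iff hn h𝓖 (hg hU) (h1.measurable hU) ?_
  filter_upwards [h] with ω hω
  rw [Set.mem_preimage, Set.mem_preimage, hω.limUnder_eq]

/-- Stocks do not jump: `S` stopped at `τ` is the limit of `S` stopped at `ρ k`, so nothing new
about the stocks is learnt at `τ` itself. -/
theorem Announces.stoppedInfo_le (h𝓕 : 𝓕 = generatedFiltration P S hS ⊔ 𝓕Y)
    (hScont : ∀ ω, ContinuousOn (fun t => S t ω) (Set.Iic T)) {σ τ : BddStoppingTime 𝓕 T}
    {ρ : ℕ → BddStoppingTime 𝓕 T} (hρ : Announces P Y σ τ ρ) :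
    stoppedInfo S τ.val ⊔ σ.past ≤ ⨆ k, (ρ k).past := by
  have hSF : generatedFiltration P S hS ≤ 𝓕 := h𝓕 ▸ le_sup_left
  have hn : ∀ t, nullEvents P ≤ 𝓕 t := fun t =>
    (nullEvents_le_generatedFiltration t).trans (hSF t)
  have hk : ∀ k, (ρ k).past ≤ ⨆ k, (ρ k).past := le_iSup (fun k => (ρ k).past)
  have hσ : σ.past ≤ ⨆ k, (ρ k).past := (BddStoppingTime.past_mono (hρ.ge 0)).trans (hk 0)
  refine sup_le (iSup_le fun t => ?_) hσ
  rw [← measurable_iff_comap_le]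
  refine measurable_of_ae_tendsto ((σ.nullEvents_le_past hn).trans hσ)
    (iSup_le fun k => (ρ k).past_le)
    (f := fun k ω => S (min t ((ρ k).val ω)) ω)
    (fun k => (measurable_stopped hSF hScont (ρ k) t).mono (hk k) le_rfl)
    ((measurable_stopped hSF hScont τ t).mono τ.past_le le_rfl) ?_
  filter_upwards [hρ.tendsto] with ω hω
  have h1 : Tendsto (fun k => min t ((ρ k).val ω)) atTop (𝓝[Set.Iic T] (min t (τ.val ω))) :=
    tendsto_nhdsWithin_iff.2 ⟨tendsto_const_nhds.min hω,
      Eventually.of_forall fun k => (min_le_right _ _).trans ((ρ k).le ω)⟩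
  exact ((hScont ω) _ ((min_le_right _ _).trans (τ.le ω))).tendsto.comp h1

end StoppedInformation

/-! ### The market local property -/

section MarketLocal

variable {Ω : Type*} {m : MeasurableSpace Ω} {P Q : Measure Ω}
  {𝓕 𝓕S : Filtration ℝ≥0 m} {T : ℝ≥0} {V : BddStoppingTime 𝓕 T → (Ω → ℝ) → Ω → ℝ}

theorem IsMarketConsistent.eq_condExp (hmc : IsMarketConsistent P Q T 𝓕 𝓕S V)
    (hV : IsDynamicEvaluation P T 𝓕 V) (σ : BddStoppingTime 𝓕 T) {H : Ω → ℝ}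
    (hH : Linf P (𝓕S T ⊔ σ.past) H) : V σ H =ᵐ[P] Q[H | σ.past] := by
  have h1 := hmc σ H 0 hH linf_zero
  rw [add_zero] at h1
  filter_upwards [h1, (hV.evaluation σ).normalized] with ω h1 h2
  rw [h1, Pi.add_apply, h2, Pi.zero_apply, add_zero]

/-- Linearity of `V σ` on financial payoffs, the source of every additive splitting. -/
theorem IsMarketConsistent.add (hmc : IsMarketConsistent P Q T 𝓕 𝓕S V)
    (hV : IsDynamicEvaluation P T 𝓕 V) (hSF : 𝓕S ≤ 𝓕) (σ : BddStoppingTime 𝓕 T) {H K : Ω → ℝ}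
    (hH : Linf P (𝓕S T ⊔ σ.past) H) (hK : Linf P (𝓕S T ⊔ σ.past) K) :
    V σ (H + K) =ᵐ[P] V σ H + V σ K := by
  have h1 := hmc σ H K hH (hK.mono (sup_le (hSF T) σ.past_le_final))
  filter_upwards [h1, hmc.eq_condExp hV σ hH] with ω h1 h2
  rw [h1, Pi.add_apply, Pi.add_apply, h2]

/-- Events known before the next jump split payoffs additively. -/
theorem IsMarketConsistent.split_of_past (hmc : IsMarketConsistent P Q T 𝓕 𝓕S V)
    (hV : IsDynamicEvaluation P T 𝓕 V) (hSF : 𝓕S ≤ 𝓕) {σ ρ : BddStoppingTime 𝓕 T}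
    (hσρ : ∀ ω, σ.val ω ≤ ρ.val ω) (hρ : ρ.past ≤ 𝓕S T ⊔ σ.past) {A : Set Ω}
    (hA : MeasurableSet[ρ.past] A) {H : Ω → ℝ} (hH : Linf P (𝓕 T) H) :
    V σ H =ᵐ[P] V σ (A.indicator H) + V σ (Aᶜ.indicator H) := by
  have hσF : 𝓕S T ⊔ σ.past ≤ 𝓕 T := sup_le (hSF T) σ.past_le_final
  have hAF : MeasurableSet[𝓕 T] A := ρ.past_le_final _ hA
  have hE := hV.evaluation ρ
  have h1 := hE.indicator hH hA
  have h2 := hE.indicator hH hA.compl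
  have m0 : Linf P (𝓕S T ⊔ σ.past) (V ρ H) := (hE.mem _ hH).mono hρ
  have m1 : Linf P (𝓕S T ⊔ σ.past) (V ρ (A.indicator H)) :=
    (hE.mem _ (hH.indicator hAF)).mono hρ
  have m2 : Linf P (𝓕S T ⊔ σ.past) (V ρ (Aᶜ.indicator H)) :=
    (hE.mem _ (hH.indicator hAF.compl)).mono hρ
  have h3 : V ρ H =ᵐ[P] V ρ (A.indicator H) + V ρ (Aᶜ.indicator H) := by
    filter_upwards [h1, h2] with ω h1 h2
    rw [Pi.add_apply, h1, h2]
    by_cases hω : ω ∈ A <;> simp [hω]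
  have h4 := (hV.evaluation σ).congr _ _ (m0.mono hσF) ((m1.add m2).mono hσF) h3
  have h5 := hmc.add hV hSF σ m1 m2
  filter_upwards [h4, h5, hV.time_consistent σ ρ hσρ _ hH,
    hV.time_consistent σ ρ hσρ _ (hH.indicator hAF),
    hV.time_consistent σ ρ hσρ _ (hH.indicator hAF.compl)] with ω h4 h5 h6 h7 h8
  rw [h6, h4, h5, Pi.add_apply, Pi.add_apply, h7, h8]

/-- An event of the limit of an increasing sequence of σ-algebras is approximated by events of
these σ-algebras. -/
theorem exists_approx_event [IsFiniteMeasure P] (ℱ : Filtration ℕ m) {A : Set Ω}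
    (hA : MeasurableSet[⨆ k, ℱ k] A) : ∃ B : ℕ → Set Ω, (∀ k, MeasurableSet[ℱ k] (B k)) ∧
      ∀ᵐ ω ∂P, ∀ᶠ k in atTop, (ω ∈ B k ↔ ω ∈ A) := by
  have hle : ⨆ k, ℱ k ≤ m := iSup_le ℱ.le
  have hg : StronglyMeasurable[⨆ k, ℱ k] (A.indicator fun _ => (1 : ℝ)) :=
    stronglyMeasurable_const.indicator hA
  have hi : Integrable (A.indicator fun _ => (1 : ℝ)) P :=
    (integrable_const (1 : ℝ)).indicator (hle _ hA)
  -- By Lévy's upward theorem the conditional probabilities of `A` converge to its indicator, so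
  -- eventually they lie on the correct side of `1 / 2`.
  refine ⟨fun k => {ω | 1 / 2 < (P[A.indicator fun _ => (1 : ℝ) | ℱ k]) ω}, fun k => ?_, ?_⟩
  · exact (stronglyMeasurable_condExp (m := ℱ k)).measurable measurableSet_Ioi
  · filter_upwards [hi.tendsto_ae_condExp hg] with ω hω
    by_cases h : ω ∈ A
    · rw [Set.indicator_of_mem h] at hω
      filter_upwards [hω.eventually (lt_mem_nhds (show (1 / 2 : ℝ) < 1 by norm_num))] with k hk
      simpa [h] using hk
    · rw [Set.indicator_of_notMem h] at hω
      filter_upwards [hω.eventually (gt_mem_nhds (show (0 : ℝ) < 1 / 2 by norm_num))] with k hk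
      simpa [h] using hk.le

theorem boundedConv_indicator {𝓗 : MeasurableSpace Ω} {H : Ω → ℝ} (hH : Linf P 𝓗 H)
    {A : Set Ω} (hA : MeasurableSet[𝓗] A) {B : ℕ → Set Ω} (hB : ∀ k, MeasurableSet[𝓗] (B k))
    (h : ∀ᵐ ω ∂P, ∀ᶠ k in atTop, (ω ∈ B k ↔ ω ∈ A)) :
    BoundedConv P 𝓗 (fun k => (B k).indicator H) (A.indicator H) := by
  refine ⟨fun k => hH.indicator (hB k), hH.indicator hA, ?_, ?_⟩
  · obtain ⟨C, hC⟩ := hH.2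
    refine ⟨C, fun k => ?_⟩
    filter_upwards [hC] with ω h
    by_cases hω : ω ∈ B k
    · simpa [hω] using h
    · simpa [hω] using (abs_nonneg _).trans h
  · filter_upwards [h] with ω hω
    refine tendsto_const_nhds.congr' ?_
    filter_upwards [hω] with k hk
    by_cases hωA : ω ∈ A
    · simp [hωA, hk.2 hωA]
    · have : ω ∉ B k := fun h => hωA (hk.1 h)
      simp [hωA, this]

/-- The increasing sequence of pasts of an increasing sequence of stopping times. -/
def pastFiltration (ρ : ℕ → BddStoppingTime 𝓕 T) (hρ : ∀ ω, Monotone fun k => (ρ k).val ω) :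
    Filtration ℕ m where
  seq k := (ρ k).past
  mono' _ _ hkl := BddStoppingTime.past_mono fun ω => hρ ω hkl
  le' k := (ρ k).past_le

/-- Market events split payoffs additively. -/
theorem IsMarketConsistent.split [IsFiniteMeasure P] (hmc : IsMarketConsistent P Q T 𝓕 𝓕S V)
    (hV : IsDynamicEvaluation P T 𝓕 V) (hSF : 𝓕S ≤ 𝓕) {σ : BddStoppingTime 𝓕 T}
    (hc : IsContinuousEval P (𝓕 T) (V σ)) {ρ : ℕ → BddStoppingTime 𝓕 T}
    (hmono : ∀ ω, Monotone fun k => (ρ k).val ω) (hσρ : ∀ k ω, σ.val ω ≤ (ρ k).val ω)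
    (hρ : ∀ k, (ρ k).past ≤ 𝓕S T ⊔ σ.past) {A : Set Ω}
    (hA : MeasurableSet[⨆ k, (ρ k).past] A) {H : Ω → ℝ} (hH : Linf P (𝓕 T) H) :
    V σ H =ᵐ[P] V σ (A.indicator H) + V σ (Aᶜ.indicator H) := by
  obtain ⟨B, hB, hBA⟩ := exists_approx_event (P := P) (pastFiltration ρ hmono) hA
  have hAF : MeasurableSet[𝓕 T] A := (iSup_le fun k => (ρ k).past_le_final) _ hA
  have hBF : ∀ k, MeasurableSet[𝓕 T] (B k) := fun k => (ρ k).past_le_final _ (hB k)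
  have c1 := hc _ _ (boundedConv_indicator hH hAF hBF hBA)
  have c2 := hc _ _ (boundedConv_indicator hH hAF.compl (fun k => (hBF k).compl) (by
    filter_upwards [hBA] with ω h
    filter_upwards [h] with k hk
    simp [hk]))
  have hs := fun k => hmc.split_of_past hV hSF (hσρ k) (hρ k) (hB k) hH
  filter_upwards [c1, c2, ae_all_iff.2 hs] with ω h1 h2 h3
  refine tendsto_nhds_unique (tendsto_const_nhds (f := (atTop : Filter ℕ))) ?_
  exact (h1.add h2).congr fun k => (h3 k).symm

end MarketLocal

/-! ### A gliding hump argument for the boundedness of the limit -/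

section GlidingHump

variable {Ω : Type*} {m : MeasurableSpace Ω} {P : Measure Ω}

/-- A sequence of variables `M k` with limit `W`, where the bounds of `W` on events of `ℱ k` are
inherited by `M k`, has a bounded limit if it is bounded along disjoint sequences of events. -/
theorem ae_bounded_of_forall_disjoint (ℱ : Filtration ℕ m) {W : Ω → ℝ} {M : ℕ → Ω → ℝ}
    (hM : ∀ k, Measurable[ℱ k] (M k))
    (hlim : ∀ᵐ ω ∂P, Tendsto (fun k => M k ω) atTop (𝓝 (W ω)))
    (havg : ∀ k D c, MeasurableSet[ℱ k] D → (∀ᵐ ω ∂P, ω ∈ D → |W ω| ≤ c) →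
      ∀ᵐ ω ∂P, ω ∈ D → |M k ω| ≤ c)
    (hN : ∀ (E : ℕ → Set Ω) (κ : ℕ → ℕ), (∀ j, MeasurableSet[ℱ (κ j)] (E j)) →
      Pairwise (Function.onFun Disjoint E) → ∃ K, ∀ j, ∀ᵐ ω ∂P, ω ∈ E j → |M (κ j) ω| ≤ K) :
    ∃ K, ∀ᵐ ω ∂P, |W ω| ≤ K := by
  classical
  set Bdd : Set Ω → ℝ → Prop := fun D c => ∀ᵐ ω ∂P, ω ∈ D → |W ω| ≤ c with hBdd
  set Alg : Set Ω → Prop := fun D => ∃ k, MeasurableSet[ℱ k] D with hAlg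
  have hdiff : ∀ {D E}, Alg D → Alg E → Alg (D \ E) := by
    rintro D E ⟨k, hk⟩ ⟨l, hl⟩
    exact ⟨max k l, (ℱ.mono (le_max_left k l) _ hk).diff (ℱ.mono (le_max_right k l) _ hl)⟩
  have hup : ∀ {D c}, Alg D → ¬ Bdd D c →
      ∃ k, MeasurableSet[ℱ k] D ∧ ¬ ∀ᵐ ω ∂P, ω ∈ D → |M k ω| ≤ c := by
    rintro D c ⟨k, hk⟩ hb
    by_contra hcon
    push Not at hcon
    have h1 : ∀ l, ∀ᵐ ω ∂P, k ≤ l → ω ∈ D → |M l ω| ≤ c := by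
      intro l
      by_cases hkl : k ≤ l
      · filter_upwards [hcon l (ℱ.mono hkl _ hk)] with ω h _ using h
      · exact Eventually.of_forall fun ω h => absurd h hkl
    refine hb ?_
    filter_upwards [ae_all_iff.2 h1, hlim] with ω h2 h3 hω
    exact le_of_tendsto h3.abs (eventually_atTop.2 ⟨k, fun l hl => h2 l hl hω⟩)
  by_contra hbad
  have huniv : ∀ c, ¬ Bdd Set.univ c := fun c h => hbad ⟨c, by simpa [hBdd] using h⟩
  -- Either from every unbounded event a piece violating any given bound can be removed with an
  -- unbounded remainder, which yields disjoint bad events, or for some unbounded `R` and level `j₀`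
  -- removing any piece that violates `j₀` leaves a bounded remainder.
  by_cases hsplit : ∀ R, Alg R → (∀ c, ¬ Bdd R c) → ∀ j : ℕ,
      ∃ D, D ⊆ R ∧ Alg D ∧ ¬ Bdd D j ∧ ∀ c, ¬ Bdd (R \ D) c
  · -- every unbounded event splits: bad events are removed one after the other
    choose! D hDR hDA hDb hRb using hsplit
    set R : ℕ → Set Ω := fun j => Nat.rec Set.univ (fun j R => R \ D R j) j with hR
    have hRs : ∀ j, R (j + 1) = R j \ D (R j) j := fun j => rfl
    have hRg : ∀ j, Alg (R j) ∧ ∀ c, ¬ Bdd (R j) c := by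
      intro j
      induction j with
      | zero => exact ⟨⟨0, MeasurableSet.univ⟩, huniv⟩
      | succ j ih =>
        rw [hRs]
        exact ⟨hdiff ih.1 (hDA _ ih.1 ih.2 j), hRb _ ih.1 ih.2 j⟩
    have hanti : Antitone R := antitone_nat_of_succ_le fun j => Set.sdiff_subset
    have hdisj : ∀ i j, i < j → Disjoint (D (R i) i) (D (R j) j) := by
      intro i j hij
      have h1 : D (R j) j ⊆ R i \ D (R i) i :=
        (hDR _ (hRg j).1 (hRg j).2 j).trans (hanti (Nat.succ_le_of_lt hij))
      exact Set.disjoint_left.2 fun ω h2 h3 => (h1 h3).2 h2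
    choose κ hκ hκb using fun j => hup (hDA _ (hRg j).1 (hRg j).2 j) (hDb _ (hRg j).1 (hRg j).2 j)
    obtain ⟨K, hK⟩ := hN (fun j => D (R j) j) κ hκ fun i j hij => by
      rcases lt_or_gt_of_ne hij with h | h
      · exact hdisj i j h
      · exact (hdisj j i h).symm
    obtain ⟨j, hj⟩ := exists_nat_ge K
    exact hκb j ((hK j).mono fun ω h hω => (h hω).trans hj)
  · push Not at hsplit
    obtain ⟨R, hRA, hRb, j₀, hR⟩ := hsplit
    choose l hlm hlb using fun n : ℕ => hup hRA (hRb n)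
    set E : ℕ → Set Ω := fun n => R ∩ {ω | (n : ℝ) < |M (l n) ω|} with hE
    have hEm : ∀ n, MeasurableSet[ℱ (l n)] (E n) := fun n =>
      (hlm n).inter ((continuous_abs.measurable.comp (hM (l n))) measurableSet_Ioi)
    -- A bound `j₀` for `W` on this event would pass to `M`, which exceeds `n + j₀` there; the event
    -- would then be null, against the choice of `l`.
    have hEb : ∀ n, ¬ Bdd (E (n + j₀)) j₀ := by
      intro n h
      have h1 := havg _ _ _ (hEm (n + j₀)) h
      refine hlb (n + j₀) ?_
      filter_upwards [h1] with ω h2 hω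
      by_contra h3
      have h4 := h2 ⟨hω, not_le.1 h3⟩
      push_cast at h3
      linarith [(n.cast_nonneg : (0 : ℝ) ≤ n)]
    set G : ℕ → Set Ω := fun n => R \ E (n + j₀) with hG
    have hGA : ∀ n, Alg (G n) := fun n => hdiff hRA ⟨_, hEm _⟩
    have hGb : ∀ n, ∃ c, Bdd (G n) c := fun n =>
      hR _ Set.inter_subset_left ⟨_, hEm _⟩ (hEb n)
    have hDA : ∀ n, Alg (disjointed G n) := fun n =>
      disjointedRec (p := Alg) (fun t i ht => hdiff ht (hGA i)) (hGA n)
    have hDb : ∀ n, ∃ N : ℕ, Bdd (disjointed G n) N := by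
      intro n
      obtain ⟨c, hc⟩ := hGb n
      obtain ⟨N, hN⟩ := exists_nat_ge c
      exact ⟨N, hc.mono fun ω h hω => (h (disjointed_subset G n hω)).trans hN⟩
    -- The least natural bound of `W` on each disjoint piece is nearly attained by some `M κ`: it
    -- exceeds that bound minus one on a non-null part. The bound along disjoint events therefore
    -- controls all these least bounds at once.
    have hκ : ∀ n, ∃ κ, MeasurableSet[ℱ κ] (disjointed G n) ∧
        (Nat.find (hDb n) = 0 ∨
          ¬ ∀ᵐ ω ∂P, ω ∈ disjointed G n → |M κ ω| ≤ (Nat.find (hDb n) : ℝ) - 1) := by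
      intro n
      rcases Nat.eq_zero_or_pos (Nat.find (hDb n)) with h | h
      · obtain ⟨k, hk⟩ := hDA n
        exact ⟨k, hk, Or.inl h⟩
      · have h1 := Nat.find_min (hDb n) (Nat.sub_lt h one_pos)
        rw [Nat.cast_pred h] at h1
        obtain ⟨k, hk, hkb⟩ := hup (hDA n) h1
        exact ⟨k, hk, Or.inr hkb⟩
    choose κ hκm hκb using hκ
    obtain ⟨K, hK⟩ := hN (disjointed G) κ hκm (disjoint_disjointed G)
    have hNK : ∀ n, (Nat.find (hDb n) : ℝ) ≤ |K| + 1 := by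
      intro n
      rcases hκb n with h | h
      · rw [h]; push_cast; positivity
      · by_contra hcon
        refine h ((hK n).mono fun ω h1 hω => (h1 hω).trans ?_)
        linarith [le_abs_self K, not_le.1 hcon]
    refine hRb (|K| + 1) ?_
    have hfind : ∀ n, ∀ᵐ ω ∂P, ω ∈ disjointed G n → |W ω| ≤ (Nat.find (hDb n) : ℝ) := fun n =>
      Nat.find_spec (hDb n)
    filter_upwards [ae_all_iff.2 hfind, hlim] with ω h1 h2 hωR
    obtain ⟨b, hb⟩ := h2.abs.bddAbove_range
    obtain ⟨n, hn⟩ := exists_nat_ge b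
    -- A convergent sequence is bounded, so almost every point of `R` escapes `E` at a large index;
    -- thus the pieces exhaust `R`.
    have hωG : ω ∈ G n := by
      refine ⟨hωR, fun h3 => ?_⟩
      have h4 : ((n + j₀ : ℕ) : ℝ) < |M (l (n + j₀)) ω| := h3.2
      have h5 := hb ⟨l (n + j₀), rfl⟩
      push_cast at h4
      linarith [(j₀.cast_nonneg : (0 : ℝ) ≤ j₀)]
    have hωD : ω ∈ ⋃ n, disjointed G n := by
      rw [iUnion_disjointed]; exact Set.mem_iUnion.2 ⟨n, hωG⟩
    obtain ⟨i, hi⟩ := Set.mem_iUnion.1 hωD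
    exact (h1 i hi).trans (hNK i)

end GlidingHump

/-! ### Evaluations at coinciding stopping times, and pasting -/

section Coincidence

variable {Ω : Type*} {m : MeasurableSpace Ω} {P : Measure Ω}
  {𝓕 : Filtration ℝ≥0 m} {T : ℝ≥0} {V : BddStoppingTime 𝓕 T → (Ω → ℝ) → Ω → ℝ}

/-- Parts of `E` known at `α` are known at `γ`, so `1_E V α H` is already `𝓕_γ`-measurable and `V γ`
leaves it unchanged; time-consistency and locality do the rest. -/
theorem IsDynamicEvaluation.eq_on_of_le (hV : IsDynamicEvaluation P T 𝓕 V)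
    {γ α : BddStoppingTime 𝓕 T} (hγα : ∀ ω, γ.val ω ≤ α.val ω) {E : Set Ω}
    (hE : MeasurableSet[α.past] E) (heq : ∀ ω ∈ E, γ.val ω = α.val ω) {H : Ω → ℝ}
    (hH : Linf P (𝓕 T) H) : ∀ᵐ ω ∂P, ω ∈ E → V γ H ω = V α H ω := by
  have hin : ∀ A, MeasurableSet[α.past] A → A ⊆ E → MeasurableSet[γ.past] A := by
    intro A hA hAE
    rw [γ.measurableSet_past_iff]
    intro t
    convert α.measurableSet_past_iff.1 hA t using 1
    ext ω
    exact and_congr_right fun hω => by simp [heq ω (hAE hω)]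
  have hEγ : MeasurableSet[γ.past] E := hin E hE subset_rfl
  have hEF : MeasurableSet[𝓕 T] E := α.past_le_final _ hE
  have hα := (hV.evaluation α).mem _ hH
  have hαT : Linf P (𝓕 T) (V α H) := hα.mono α.past_le_final
  have hm : Linf P γ.past (E.indicator (V α H)) := by
    obtain ⟨g, hg, hVg⟩ := hα.1
    refine ⟨⟨E.indicator g, ?_, ?_⟩, (hαT.indicator hEF).2⟩
    · refine Measurable.stronglyMeasurable fun U hU => ?_
      by_cases h0 : (0 : ℝ) ∈ U
      · have : E.indicator g ⁻¹' U = (E ∩ g ⁻¹' Uᶜ)ᶜ := by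
          ext ω; by_cases hω : ω ∈ E <;> simp [hω, h0]
        rw [this]
        exact (hin _ (hE.inter (hg.measurable hU.compl)) Set.inter_subset_left).compl
      · have : E.indicator g ⁻¹' U = E ∩ g ⁻¹' U := by
          ext ω; by_cases hω : ω ∈ E <;> simp [hω, h0]
        rw [this]
        exact hin _ (hE.inter (hg.measurable hU)) Set.inter_subset_left
    · filter_upwards [hVg] with ω h
      by_cases hω : ω ∈ E <;> simp [hω, h]
  have h1 := (hV.evaluation γ).const hm
  have h2 := (hV.evaluation γ).isLocalMap.ae_eq_on γ.past_le_final hαT (hαT.indicator hEF) hEγ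
    (Eventually.of_forall fun ω hω => by simp [hω])
  filter_upwards [h1, h2, hV.time_consistent γ α hγα H hH] with ω h1 h2 h3 hω
  rw [h3, h2 hω, h1, Set.indicator_of_mem hω]

/-- Evaluations at stopping times which coincide on an event coincide on this event. -/
theorem IsDynamicEvaluation.eq_on (hV : IsDynamicEvaluation P T 𝓕 V)
    {α β : BddStoppingTime 𝓕 T} {E : Set Ω} (hE : MeasurableSet[α.past] E)
    (heq : ∀ ω ∈ E, α.val ω = β.val ω) {H : Ω → ℝ} (hH : Linf P (𝓕 T) H) :
    ∀ᵐ ω ∂P, ω ∈ E → V α H ω = V β H ω := by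
  have hE' : MeasurableSet[β.past] E := by
    rw [β.measurableSet_past_iff]
    intro t
    convert α.measurableSet_past_iff.1 hE t using 1
    ext ω
    exact and_congr_right fun hω => by simp [heq ω hω]
  let γ : BddStoppingTime 𝓕 T := ⟨fun ω => min (α.val ω) (β.val ω),
    α.isStoppingTime.min β.isStoppingTime, fun ω => (min_le_left _ _).trans (α.le ω)⟩
  filter_upwards [hV.eq_on_of_le (γ := γ) (α := α) (fun ω => min_le_left _ _) hE
      (fun ω hω => by simp [γ, heq ω hω]) hH,
    hV.eq_on_of_le (γ := γ) (α := β) (fun ω => min_le_right _ _) hE'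
      (fun ω hω => by simp [γ, heq ω hω]) hH] with ω h1 h2 hω
  rw [← h1 hω, h2 hω]

/-- Evaluations along a bounded increasing sequence of stopping times are bounded on disjoint
sequences of events. -/
theorem IsDynamicEvaluation.bounded_on_disjoint (hV : IsDynamicEvaluation P T 𝓕 V)
    {ρ : ℕ → BddStoppingTime 𝓕 T} {τ : BddStoppingTime 𝓕 T}
    (hρτ : ∀ k ω, (ρ k).val ω ≤ τ.val ω) {E : ℕ → Set Ω} {κ : ℕ → ℕ}
    (hE : ∀ j, MeasurableSet[(ρ (κ j)).past] (E j)) (hd : Pairwise (Function.onFun Disjoint E))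
    {H : Ω → ℝ} (hH : Linf P (𝓕 T) H) :
    ∃ K, ∀ j, ∀ᵐ ω ∂P, ω ∈ E j → |V (ρ (κ j)) H ω| ≤ K := by
  classical
  have huniq : ∀ {ω i j}, ω ∈ E i → ω ∈ E j → i = j := by
    intro ω i j hi hj
    by_contra hij
    exact Set.disjoint_left.1 (hd hij) hi hj
  -- All the evaluations are merged into one, at the time equal to `ρ (κ j)` on `E j` and to `τ`
  -- elsewhere. The single variable `V α H` is bounded, which gives one `K` for all `j`.
  set r : Ω → ℝ≥0 := fun ω =>
    if h : ∃ j, ω ∈ E j then (ρ (κ (Nat.find h))).val ω else τ.val ω with hr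
  have hrE : ∀ {ω j}, ω ∈ E j → r ω = (ρ (κ j)).val ω := by
    intro ω j hj
    have h : ∃ j, ω ∈ E j := ⟨j, hj⟩
    simp only [hr, h, dif_pos]
    rw [huniq (Nat.find_spec h) hj]
  have hrτ : ∀ ω, r ω ≤ τ.val ω := by
    intro ω
    by_cases h : ∃ j, ω ∈ E j
    · obtain ⟨j, hj⟩ := h; rw [hrE hj]; exact hρτ _ _
    · simp [hr, h]
  have hst : IsStoppingTime 𝓕 (fun ω => ((r ω : ℝ≥0) : WithTop ℝ≥0)) := by
    rw [isStoppingTime_coe_iff]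
    intro t
    -- Since `r ≤ τ` everywhere, `{τ ≤ t}` may be included without intersecting it with the
    -- complement of the `E j`, which need not be known at time `t`.
    have : {ω | r ω ≤ t} = {ω | τ.val ω ≤ t} ∪ ⋃ j, (E j ∩ {ω | (ρ (κ j)).val ω ≤ t}) := by
      ext ω
      simp only [Set.mem_ofPred_eq, Set.mem_union, Set.mem_iUnion, Set.mem_inter_iff]
      constructor
      · intro h
        by_cases hj : ∃ j, ω ∈ E j
        · obtain ⟨j, hj⟩ := hj; exact Or.inr ⟨j, hj, hrE hj ▸ h⟩
        · left; simpa [hr, hj] using h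
      · rintro (h | ⟨j, hj, h⟩)
        · exact (hrτ ω).trans h
        · rwa [hrE hj]
    rw [this]
    exact (τ.measurableSet_le t).union
      (MeasurableSet.iUnion fun j => (ρ (κ j)).measurableSet_past_iff.1 (hE j) t)
  let α : BddStoppingTime 𝓕 T := ⟨r, hst, fun ω => (hrτ ω).trans (τ.le ω)⟩
  obtain ⟨K, hK⟩ := ((hV.evaluation α).mem H hH).2
  refine ⟨K, fun j => ?_⟩
  filter_upwards [hK, hV.eq_on (β := α) (hE j) (fun ω hω => (hrE hω).symm) hH] with ω h1 h2 hω
  rwa [h2 hω]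

end Coincidence

/-! ### The market density by the Radon-Nikodym theorem -/

section Density

theorem exists_density_of_hasSum {Ω : Type*} [MeasurableSpace Ω] (μ : Measure Ω) [IsFiniteMeasure μ]
    (v : Set Ω → ℝ) (hac : ∀ A, MeasurableSet A → μ A = 0 → v A = 0)
    (hsum : ∀ f : ℕ → Set Ω, (∀ i, MeasurableSet (f i)) → Pairwise (Function.onFun Disjoint f) →
      HasSum (fun i => v (f i)) (v (⋃ i, f i))) :
    ∃ w : Ω → ℝ, StronglyMeasurable w ∧ Integrable w μ ∧
      ∀ A, MeasurableSet A → ∫ ω in A, w ω ∂μ = v A := by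
  classical
  let s : SignedMeasure Ω :=
    { measureOf' := fun A => if MeasurableSet A then v A else 0
      empty' := by simp [hac ∅ MeasurableSet.empty measure_empty]
      not_measurable' := fun A hA => by simp [hA]
      m_iUnion' := fun f hf hd => by
        simpa [hf, MeasurableSet.iUnion hf] using hsum f hf hd }
  have hs : ∀ A, MeasurableSet A → s A = v A := fun A hA => if_pos hA
  have h1 : s ≪ᵥ μ.toENNRealVectorMeasure := by
    refine VectorMeasure.AbsolutelyContinuous.mk fun A hA h => ?_
    rw [Measure.toENNRealVectorMeasure_apply_measurable hA] at h
    rw [hs A hA, hac A hA h]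
  refine ⟨s.rnDeriv μ, (SignedMeasure.measurable_rnDeriv s μ).stronglyMeasurable,
    SignedMeasure.integrable_rnDeriv s μ, fun A hA => ?_⟩
  rw [← withDensityᵥ_apply (SignedMeasure.integrable_rnDeriv s μ) hA,
    SignedMeasure.withDensityᵥ_rnDeriv_eq s μ h1, hs A hA]

variable {Ω : Type*} {𝓖 𝓢 𝓗 : MeasurableSpace Ω} {m : MeasurableSpace Ω} {P Q : Measure Ω}
  {V W : (Ω → ℝ) → Ω → ℝ}

/-- Passing to the trimmed measure means that only events of `𝓢` have to be tested. -/
theorem ae_le_of_setIntegral_le [IsFiniteMeasure Q] (h𝓢 : 𝓢 ≤ m) {f g : Ω → ℝ}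
    (hf : StronglyMeasurable[𝓢] f) (hg : StronglyMeasurable[𝓢] g) (hfi : Integrable f Q)
    (hgi : Integrable g Q)
    (h : ∀ A, MeasurableSet[𝓢] A → ∫ ω in A, f ω ∂Q ≤ ∫ ω in A, g ω ∂Q) : f ≤ᵐ[Q] g := by
  refine ae_le_of_ae_le_trim (hm := h𝓢) ?_
  refine @ae_le_of_forall_setIntegral_le Ω 𝓢 (Q.trim h𝓢) f g (hfi.trim h𝓢 hf) (hgi.trim h𝓢 hg) ?_
  intro A hA _
  rw [← setIntegral_trim h𝓢 hf hA, ← setIntegral_trim h𝓢 hg hA]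
  exact h A hA

theorem ae_eq_of_setIntegral_eq [IsFiniteMeasure Q] (h𝓢 : 𝓢 ≤ m) {f g : Ω → ℝ}
    (hf : StronglyMeasurable[𝓢] f) (hg : StronglyMeasurable[𝓢] g) (hfi : Integrable f Q)
    (hgi : Integrable g Q)
    (h : ∀ A, MeasurableSet[𝓢] A → ∫ ω in A, f ω ∂Q = ∫ ω in A, g ω ∂Q) : f =ᵐ[Q] g :=
  (ae_le_of_setIntegral_le h𝓢 hf hg hfi hgi fun A hA => (h A hA).le).antisymm
    (ae_le_of_setIntegral_le h𝓢 hg hf hgi hfi fun A hA => (h A hA).ge)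

/-- A continuous conditional evaluation `V : L^∞(𝓗) → L^∞(𝓖)` which is bounded on bounded sets,
is a linear price on the intermediate information `𝓢`, and splits additively on its events. -/
structure IsMarketSplit (P Q : Measure Ω) (𝓗 𝓢 𝓖 : MeasurableSpace Ω)
    (V : (Ω → ℝ) → Ω → ℝ) : Prop where
  evaluation : IsConditionalEvaluation P 𝓗 𝓖 V
  le_final : 𝓗 ≤ m
  le_upper : 𝓢 ≤ 𝓗
  le_lower : 𝓖 ≤ 𝓢
  prob : IsProbabilityMeasure Q
  ac : Q ≪ P
  ac' : P ≪ Q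
  split : ∀ A H, MeasurableSet[𝓢] A → Linf P 𝓗 H →
    V H =ᵐ[P] V (A.indicator H) + V (Aᶜ.indicator H)
  continuous : IsContinuousEval P 𝓗 V
  bounded : IsUniformlyBounded P 𝓗 V
  price : ∀ c H, Linf P 𝓢 c → Linf P 𝓗 H → V (c + H) =ᵐ[P] Q[c | 𝓖] + V H

/-- `W H` is the `𝓢`-measurable density of `A ↦ E_Q[V (1_A H)]`. -/
def IsMarketDensity (P Q : Measure Ω) (𝓗 𝓢 : MeasurableSpace Ω)
    (V W : (Ω → ℝ) → Ω → ℝ) : Prop :=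
  ∀ H, Linf P 𝓗 H → StronglyMeasurable[𝓢] (W H) ∧ Integrable (W H) Q ∧
    ∀ A, MeasurableSet[𝓢] A → ∫ ω in A, W H ω ∂Q = ∫ ω, V (A.indicator H) ω ∂Q

namespace IsMarketSplit

theorem integrable (hV : IsMarketSplit P Q 𝓗 𝓢 𝓖 V) {H : Ω → ℝ} (hH : Linf P 𝓗 H) :
    Integrable (V H) Q :=
  have := hV.prob
  (hV.evaluation.mem H hH).integrable hV.ac
    ((hV.le_lower.trans hV.le_upper).trans hV.le_final)

/-- Dominated convergence; uniform boundedness of `V` on bounded sets provides the constant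
majorant. -/
theorem tendsto_integral (hV : IsMarketSplit P Q 𝓗 𝓢 𝓖 V) {Hs : ℕ → Ω → ℝ} {H : Ω → ℝ}
    (h : BoundedConv P 𝓗 Hs H) :
    Tendsto (fun k => ∫ ω, V (Hs k) ω ∂Q) atTop (𝓝 (∫ ω, V H ω ∂Q)) := by
  have := hV.prob
  obtain ⟨C, hC⟩ := h.bounded
  obtain ⟨K, hK⟩ := hV.bounded C
  refine tendsto_integral_of_dominated_convergence (fun _ => K)
    (fun k => (hV.integrable (h.seq_mem k)).aestronglyMeasurable) (integrable_const K)
    (fun k => hV.ac.ae_le ?_) (hV.ac.ae_le (hV.continuous Hs H h))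
  exact hK _ (h.seq_mem k) (hC k)

theorem integral_union (hV : IsMarketSplit P Q 𝓗 𝓢 𝓖 V) {H : Ω → ℝ} (hH : Linf P 𝓗 H)
    {A B : Set Ω} (hA : MeasurableSet[𝓢] A) (hB : MeasurableSet[𝓢] B) (hAB : Disjoint A B) :
    ∫ ω, V ((A ∪ B).indicator H) ω ∂Q =
      ∫ ω, V (A.indicator H) ω ∂Q + ∫ ω, V (B.indicator H) ω ∂Q := by
  have hU := hH.indicator (hV.le_upper _ (hA.union hB))
  have h1 := hV.split A _ hA hU
  have e1 : A.indicator ((A ∪ B).indicator H) = A.indicator H := by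
    ext ω; by_cases h : ω ∈ A <;> simp [h]
  have e2 : Aᶜ.indicator ((A ∪ B).indicator H) = B.indicator H := by
    ext ω
    by_cases h : ω ∈ A
    · simp [h, Set.disjoint_left.1 hAB h]
    · by_cases h' : ω ∈ B <;> simp [h, h']
  rw [e1, e2] at h1
  rw [← integral_add (hV.integrable (hH.indicator (hV.le_upper _ hA)))
    (hV.integrable (hH.indicator (hV.le_upper _ hB)))]
  exact integral_congr_ae (hV.ac.ae_le h1)

theorem integral_biUnion (hV : IsMarketSplit P Q 𝓗 𝓢 𝓖 V) {H : Ω → ℝ} (hH : Linf P 𝓗 H)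
    {f : ℕ → Set Ω} (hf : ∀ i, MeasurableSet[𝓢] (f i))
    (hd : Pairwise (Function.onFun Disjoint f)) (s : Finset ℕ) :
    ∫ ω, V ((⋃ i ∈ s, f i).indicator H) ω ∂Q = ∑ i ∈ s, ∫ ω, V ((f i).indicator H) ω ∂Q := by
  classical
  induction s using Finset.induction_on with
  | empty =>
    simp only [Finset.notMem_empty, Set.iUnion_of_empty, Set.iUnion_empty, Set.indicator_empty,
      Finset.sum_empty]
    exact integral_eq_zero_of_ae (hV.ac.ae_le hV.evaluation.normalized)
  | insert i s his ih =>
    rw [Finset.set_biUnion_insert, Finset.sum_insert his, ← ih]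
    refine hV.integral_union hH (hf i) (Finset.measurableSet_biUnion s fun j _ => hf j) ?_
    refine Set.disjoint_iUnion₂_right.2 fun j hj => hd ?_
    rintro rfl
    exact his hj

/-- The splitting gives finite additivity, continuity of `V` upgrades it to countable additivity,
and null events have value zero. -/
theorem exists_isMarketDensity (hV : IsMarketSplit P Q 𝓗 𝓢 𝓖 V) :
    ∃ W, IsMarketDensity P Q 𝓗 𝓢 V W := by
  classical
  have := hV.prob
  have h𝓢 : 𝓢 ≤ m := hV.le_upper.trans hV.le_final
  have hex : ∀ H, ∃ w : Ω → ℝ, Linf P 𝓗 H → StronglyMeasurable[𝓢] w ∧ Integrable w Q ∧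
      ∀ A, MeasurableSet[𝓢] A → ∫ ω in A, w ω ∂Q = ∫ ω, V (A.indicator H) ω ∂Q := by
    intro H
    by_cases hH : Linf P 𝓗 H
    swap
    · exact ⟨0, fun h => absurd h hH⟩
    obtain ⟨w, hw1, hw2, hw3⟩ := @exists_density_of_hasSum Ω 𝓢 (Q.trim h𝓢) _
      (fun A => ∫ ω, V (A.indicator H) ω ∂Q) (by
        intro A hA hA0
        rw [trim_measurableSet_eq h𝓢 hA] at hA0
        have h0 : A.indicator H =ᵐ[P] 0 := by
          have : ∀ᵐ ω ∂P, ω ∉ A := measure_eq_zero_iff_ae_notMem.1 (hV.ac' hA0)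
          filter_upwards [this] with ω hω
          simp [hω]
        have h1 := hV.evaluation.congr _ _ (hH.indicator (hV.le_upper _ hA)) linf_zero h0
        exact integral_eq_zero_of_ae (hV.ac.ae_le (h1.trans hV.evaluation.normalized)))
      (by
        intro f hf hd
        -- Summability is convergence along finite sets of indices; it is tested on sequences of
        -- such sets because continuity of `V` concerns sequences.
        refine tendsto_of_seq_tendsto fun s hs => ?_
        have h1 := boundedConv_indicator (P := P) hH
          (hV.le_upper _ (MeasurableSet.iUnion hf))
          (B := fun k => ⋃ i ∈ s k, f i)
          (fun k => hV.le_upper _ (Finset.measurableSet_biUnion _ fun i _ => hf i))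
          (Eventually.of_forall fun ω => by
            by_cases hω : ω ∈ ⋃ i, f i
            · obtain ⟨i, hi⟩ := Set.mem_iUnion.1 hω
              filter_upwards [hs.eventually (eventually_ge_atTop {i})] with k hk
              exact ⟨fun _ => hω, fun _ => Set.mem_iUnion₂.2
                ⟨i, hk (Finset.mem_singleton_self i), hi⟩⟩
            · refine Eventually.of_forall fun k => ⟨fun h => ?_, fun h => absurd h hω⟩
              obtain ⟨i, _, hi⟩ := Set.mem_iUnion₂.1 h
              exact Set.mem_iUnion.2 ⟨i, hi⟩)
        exact (hV.tendsto_integral h1).congr fun k => hV.integral_biUnion hH hf hd (s k))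
    refine ⟨w, fun _ => ⟨hw1, integrable_of_integrable_trim h𝓢 hw2, fun A hA => ?_⟩⟩
    rw [setIntegral_trim h𝓢 hw1 hA, hw3 A hA]
  choose W hW using hex
  exact ⟨W, hW⟩

end IsMarketSplit

end Density

/-! ### The densities satisfy the axioms of a conditional evaluation -/

section DensityProperties

variable {Ω : Type*} {𝓖 𝓢 𝓗 : MeasurableSpace Ω} {m : MeasurableSpace Ω} {P Q : Measure Ω}
  {V W : (Ω → ℝ) → Ω → ℝ}

namespace IsMarketDensity

theorem congr (hV : IsMarketSplit P Q 𝓗 𝓢 𝓖 V) (hW : IsMarketDensity P Q 𝓗 𝓢 V W)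
    {H₁ H₂ : Ω → ℝ} (h₁ : Linf P 𝓗 H₁) (h₂ : Linf P 𝓗 H₂) (h : H₁ =ᵐ[P] H₂) :
    W H₁ =ᵐ[P] W H₂ := by
  have := hV.prob
  obtain ⟨a1, a2, a3⟩ := hW H₁ h₁
  obtain ⟨b1, b2, b3⟩ := hW H₂ h₂
  refine hV.ac'.ae_le (ae_eq_of_setIntegral_eq (hV.le_upper.trans hV.le_final) a1 b1 a2 b2 ?_)
  intro A hA
  rw [a3 A hA, b3 A hA]
  refine integral_congr_ae (hV.ac.ae_le (hV.evaluation.congr _ _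
    (h₁.indicator (hV.le_upper _ hA)) (h₂.indicator (hV.le_upper _ hA)) ?_))
  filter_upwards [h] with ω hω
  by_cases hωA : ω ∈ A <;> simp [hωA, hω]

/-- For `B ∈ 𝓢`, splitting along `B ∩ A` separates the contributions of `H₁` and `H₂` to the
integral over `B`. -/
theorem isLocalMap (hV : IsMarketSplit P Q 𝓗 𝓢 𝓖 V) (hW : IsMarketDensity P Q 𝓗 𝓢 V W) :
    IsLocalMap P 𝓗 𝓢 W := by
  have := hV.prob
  refine ⟨fun H₁ H₂ h₁ h₂ h => hW.congr hV h₁ h₂ h, fun H₁ H₂ A h₁ h₂ hA => ?_⟩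
  have h𝓢 : 𝓢 ≤ m := hV.le_upper.trans hV.le_final
  have hA' := hV.le_upper _ hA
  have hL := (h₁.indicator hA').add (h₂.indicator hA'.compl)
  obtain ⟨a1, a2, a3⟩ := hW H₁ h₁
  obtain ⟨b1, b2, b3⟩ := hW H₂ h₂
  obtain ⟨c1, c2, c3⟩ := hW _ hL
  have i1 := a2.indicator (h𝓢 _ hA)
  have i2 := b2.indicator (h𝓢 _ hA.compl)
  refine hV.ac'.ae_le (ae_eq_of_setIntegral_eq h𝓢 c1
    ((a1.indicator hA).add (b1.indicator hA.compl)) c2 (i1.add i2) ?_)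
  intro B hB
  have e : B.indicator (A.indicator H₁ + Aᶜ.indicator H₂) =
      (B ∩ A).indicator H₁ + (B ∩ Aᶜ).indicator H₂ := by
    ext ω
    by_cases h1 : ω ∈ A <;> by_cases h2 : ω ∈ B <;> simp [h1, h2]
  have e1 : (B ∩ A).indicator ((B ∩ A).indicator H₁ + (B ∩ Aᶜ).indicator H₂) =
      (B ∩ A).indicator H₁ := by
    ext ω
    by_cases h1 : ω ∈ A <;> by_cases h2 : ω ∈ B <;> simp [h1, h2]
  have e2 : (B ∩ A)ᶜ.indicator ((B ∩ A).indicator H₁ + (B ∩ Aᶜ).indicator H₂) =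
      (B ∩ Aᶜ).indicator H₂ := by
    ext ω
    by_cases h1 : ω ∈ A <;> by_cases h2 : ω ∈ B <;> simp [h1, h2]
  have l1 := h₁.indicator (hV.le_upper _ (hB.inter hA))
  have l2 := h₂.indicator (hV.le_upper _ (hB.inter hA.compl))
  have hs := hV.split (B ∩ A) _ (hB.inter hA) (l1.add l2)
  rw [e1, e2] at hs
  rw [c3 B hB, e, integral_congr_ae (hV.ac.ae_le hs)]
  simp only [Pi.add_apply]
  rw [integral_add (hV.integrable l1) (hV.integrable l2),
    integral_add i1.integrableOn i2.integrableOn, setIntegral_indicator (h𝓢 _ hA),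
    setIntegral_indicator (h𝓢 _ hA.compl), a3 _ (hB.inter hA), b3 _ (hB.inter hA.compl)]

theorem normalized (hV : IsMarketSplit P Q 𝓗 𝓢 𝓖 V) (hW : IsMarketDensity P Q 𝓗 𝓢 V W) :
    W 0 =ᵐ[P] 0 := by
  have := hV.prob
  obtain ⟨a1, a2, a3⟩ := hW 0 linf_zero
  refine hV.ac'.ae_le (ae_eq_of_setIntegral_eq (hV.le_upper.trans hV.le_final) a1
    stronglyMeasurable_zero a2 (integrable_zero _ _ _) ?_)
  intro A hA
  rw [a3 A hA]
  have : A.indicator (0 : Ω → ℝ) = 0 := Set.indicator_zero _ _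
  rw [this, integral_eq_zero_of_ae (hV.ac.ae_le hV.evaluation.normalized)]
  simp

theorem cash (hV : IsMarketSplit P Q 𝓗 𝓢 𝓖 V) (hW : IsMarketDensity P Q 𝓗 𝓢 V W)
    {H c : Ω → ℝ} (hH : Linf P 𝓗 H) (hc : Linf P 𝓢 c) : W (H + c) =ᵐ[P] W H + c := by
  have := hV.prob
  have h𝓢 : 𝓢 ≤ m := hV.le_upper.trans hV.le_final
  have h𝓖 : 𝓖 ≤ m := hV.le_lower.trans h𝓢
  obtain ⟨d, hd, hcd⟩ := hc.1
  have hdL : Linf P 𝓢 d := hc.congr hcd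
  obtain ⟨a1, a2, a3⟩ := hW H hH
  obtain ⟨b1, b2, b3⟩ := hW _ (hH.add (hc.mono hV.le_upper))
  have hdi : Integrable d Q := hdL.integrable hV.ac h𝓢
  have key : W (H + c) =ᵐ[Q] W H + d := by
    refine ae_eq_of_setIntegral_eq h𝓢 b1 (a1.add hd) b2 (a2.add hdi) ?_
    intro A hA
    have hcA := hc.indicator hA
    have hHA := hH.indicator (hV.le_upper _ hA)
    have h1 := hV.price _ _ hcA hHA
    rw [add_comm, ← Set.indicator_add'] at h1
    simp only [Pi.add_apply]
    rw [b3 A hA, integral_congr_ae (hV.ac.ae_le h1),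
      integral_add a2.integrableOn hdi.integrableOn, a3 A hA]
    simp only [Pi.add_apply]
    rw [integral_add integrable_condExp (hV.integrable hHA), integral_condExp h𝓖, add_comm,
      integral_indicator (h𝓢 _ hA)]
    congr 1
    have hcd' : c =ᵐ[Q] d := hV.ac.ae_le hcd
    exact setIntegral_congr_ae (h𝓢 _ hA) (hcd'.mono fun ω h _ => h)
  filter_upwards [hV.ac'.ae_le key, hcd] with ω h1 h2
  rw [h1, Pi.add_apply, Pi.add_apply, h2]

theorem tendsto_setIntegral (hV : IsMarketSplit P Q 𝓗 𝓢 𝓖 V) (hW : IsMarketDensity P Q 𝓗 𝓢 V W)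
    {Hs : ℕ → Ω → ℝ} {H : Ω → ℝ} (h : BoundedConv P 𝓗 Hs H) {A : Set Ω}
    (hA : MeasurableSet[𝓢] A) :
    Tendsto (fun k => ∫ ω in A, W (Hs k) ω ∂Q) atTop (𝓝 (∫ ω in A, W H ω ∂Q)) := by
  have hA' := hV.le_upper _ hA
  have h1 : BoundedConv P 𝓗 (fun k => A.indicator (Hs k)) (A.indicator H) := by
    refine ⟨fun k => (h.seq_mem k).indicator hA', h.lim_mem.indicator hA', ?_, ?_⟩
    · obtain ⟨C, hC⟩ := h.bounded
      refine ⟨C, fun k => ?_⟩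
      filter_upwards [hC k] with ω hω
      by_cases hωA : ω ∈ A
      · simpa [hωA] using hω
      · simpa [hωA] using (abs_nonneg _).trans hω
    · filter_upwards [h.tendsto] with ω hω
      by_cases hωA : ω ∈ A <;> simp [hωA, hω]
  have h2 := hV.tendsto_integral h1
  rw [← (hW H h.lim_mem).2.2 A hA] at h2
  exact h2.congr fun k => ((hW _ (h.seq_mem k)).2.2 A hA).symm

/-- On the event `A` where `W (Hs k) < W H - ε` infinitely often, select such an index `k ≥ n`. The
selected payoffs still converge boundedly to `H`, so their densities integrate over `A` to something
converging to `∫_A W H`, while remaining at most `∫_A (W H - ε)`. Hence `A` is null. -/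
theorem eventually_ge (hV : IsMarketSplit P Q 𝓗 𝓢 𝓖 V) (hW : IsMarketDensity P Q 𝓗 𝓢 V W)
    {Hs : ℕ → Ω → ℝ} {H : Ω → ℝ} (h : BoundedConv P 𝓗 Hs H) {ε : ℝ} (hε : 0 < ε) :
    ∀ᵐ ω ∂P, ∀ᶠ k in atTop, W H ω - ε ≤ W (Hs k) ω := by
  classical
  have := hV.prob
  have h𝓢 : 𝓢 ≤ m := hV.le_upper.trans hV.le_final
  obtain ⟨a1, a2, a3⟩ := hW H h.lim_mem
  have hm : ∀ k, Measurable[𝓢] (W (Hs k)) := fun k => (hW _ (h.seq_mem k)).1.measurable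
  have hlt : ∀ k, MeasurableSet[𝓢] {ω | W (Hs k) ω < W H ω - ε} := fun k =>
    @measurableSet_lt _ _ _ _ _ 𝓢 _ _ _ _ _ (hm k)
      ((continuous_sub_right ε).measurable.comp a1.measurable)
  set A : Set Ω := {ω | ∀ n, ∃ k, n ≤ k ∧ W (Hs k) ω < W H ω - ε} with hA
  have hAm : MeasurableSet[𝓢] A := by
    have : A = ⋂ n, ⋃ k ∈ {k | n ≤ k}, {ω | W (Hs k) ω < W H ω - ε} := by
      ext ω; simp [hA]
    rw [this]
    exact MeasurableSet.iInter fun n => MeasurableSet.biUnion (Set.to_countable _) fun k _ => hlt k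
  have hex : ∀ n ω, ∃ k, n ≤ k ∧ (ω ∈ A → W (Hs k) ω < W H ω - ε) := by
    intro n ω
    by_cases hω : ω ∈ A
    · obtain ⟨k, hk, hk'⟩ := hω n
      exact ⟨k, hk, fun _ => hk'⟩
    · exact ⟨n, le_rfl, fun h => absurd h hω⟩
  have hνm : ∀ n, Measurable[𝓢] fun ω => Nat.find (hex n ω) := by
    intro n
    refine @measurable_find _ 𝓢 _ _ (hex n) fun k => ?_
    by_cases hk : n ≤ k
    · have : {ω | n ≤ k ∧ (ω ∈ A → W (Hs k) ω < W H ω - ε)} =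
          Aᶜ ∪ {ω | W (Hs k) ω < W H ω - ε} := by
        ext ω; simp [hk, imp_iff_not_or]
      rw [this]
      exact hAm.compl.union (hlt k)
    · simp [hk]
  obtain ⟨C, hC⟩ := h.bounded
  set X : ℕ → Ω → ℝ := fun n ω => Hs (Nat.find (hex n ω)) ω with hX
  have hXL : ∀ n, Linf P 𝓗 (X n) := fun n =>
    linf_select h.seq_mem hC ((hνm n).mono hV.le_upper le_rfl)
  have hXc : BoundedConv P 𝓗 X H := by
    refine ⟨hXL, h.lim_mem, ⟨C, fun n => ?_⟩, ?_⟩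
    · filter_upwards [ae_all_iff.2 hC] with ω hω using hω _
    · filter_upwards [h.tendsto] with ω hω
      have : Tendsto (fun n => Nat.find (hex n ω)) atTop atTop :=
        tendsto_atTop_mono (fun n => (Nat.find_spec (hex n ω)).1) tendsto_id
      exact hω.comp this
  have hXW : ∀ n, W (X n) =ᵐ[P] fun ω => W (Hs (Nat.find (hex n ω))) ω := fun n =>
    (hW.isLocalMap hV).select hV.le_upper h.seq_mem hC (hνm n)
  have hAm' : MeasurableSet A := h𝓢 _ hAm
  have hle : ∀ n, ∫ ω in A, W (X n) ω ∂Q ≤ ∫ ω in A, (W H ω - ε) ∂Q := by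
    intro n
    refine setIntegral_mono_on_ae (hW _ (hXL n)).2.1.integrableOn
      (a2.sub (integrable_const ε)).integrableOn hAm' ?_
    filter_upwards [hV.ac.ae_le (hXW n)] with ω hω hωA
    rw [hω]
    exact ((Nat.find_spec (hex n ω)).2 hωA).le
  have hlim := le_of_tendsto' (hW.tendsto_setIntegral hV hXc hAm) hle
  rw [integral_sub a2.integrableOn (integrable_const ε).integrableOn, setIntegral_const,
    smul_eq_mul] at hlim
  have hQA : Q.real A = 0 := by
    have h0 : 0 ≤ Q.real A := measureReal_nonneg
    nlinarith
  have hPA : P A = 0 := hV.ac' ((measureReal_eq_zero_iff).1 hQA)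
  filter_upwards [measure_eq_zero_iff_ae_notMem.1 hPA] with ω hω
  simp only [hA, Set.mem_ofPred_eq, not_forall, not_exists, not_and, not_lt] at hω
  obtain ⟨n, hn⟩ := hω
  exact eventually_atTop.2 ⟨n, hn⟩

theorem fatou (hV : IsMarketSplit P Q 𝓗 𝓢 𝓖 V) (hW : IsMarketDensity P Q 𝓗 𝓢 V W)
    {Hs : ℕ → Ω → ℝ} {H : Ω → ℝ} (h : BoundedConv P 𝓗 Hs H) :
    ∀ᵐ ω ∂P, ((W H ω : ℝ) : EReal) ≤ liminf (fun k => ((W (Hs k) ω : ℝ) : EReal)) atTop := by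
  have h1 : ∀ j : ℕ, ∀ᵐ ω ∂P, ∀ᶠ k in atTop, W H ω - 1 / (j + 1 : ℝ) ≤ W (Hs k) ω := fun j =>
    hW.eventually_ge hV h (by positivity)
  filter_upwards [ae_all_iff.2 h1] with ω hω
  have h2 : ∀ j : ℕ, ((W H ω - 1 / (j + 1 : ℝ) : ℝ) : EReal) ≤
      liminf (fun k => ((W (Hs k) ω : ℝ) : EReal)) atTop := fun j =>
    le_liminf_of_le (by isBoundedDefault) ((hω j).mono fun k hk => EReal.coe_le_coe_iff.2 hk)
  have h3 : Tendsto (fun j : ℕ => W H ω - 1 / (j + 1 : ℝ)) atTop (𝓝 (W H ω)) := by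
    simpa using tendsto_const_nhds.sub (tendsto_one_div_add_atTop_nhds_zero_nat (𝕜 := ℝ))
  exact le_of_tendsto' ((continuous_coe_real_ereal.tendsto _).comp h3) h2

theorem convex_const (hV : IsMarketSplit P Q 𝓗 𝓢 𝓖 V) (hW : IsMarketDensity P Q 𝓗 𝓢 V W)
    {H₁ H₂ : Ω → ℝ} (h₁ : Linf P 𝓗 H₁) (h₂ : Linf P 𝓗 H₂) {c : ℝ} (hc0 : 0 ≤ c) (hc1 : c ≤ 1) :
    W (fun ω => c * H₁ ω + (1 - c) * H₂ ω) ≤ᵐ[P] fun ω => c * W H₁ ω + (1 - c) * W H₂ ω := by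
  have := hV.prob
  have hL : Linf P 𝓗 (fun ω => c * H₁ ω + (1 - c) * H₂ ω) :=
    ((linf_const c).mul h₁).add ((linf_const (1 - c)).mul h₂)
  obtain ⟨a1, a2, a3⟩ := hW H₁ h₁
  obtain ⟨b1, b2, b3⟩ := hW H₂ h₂
  obtain ⟨d1, d2, d3⟩ := hW _ hL
  refine hV.ac'.ae_le (ae_le_of_setIntegral_le (hV.le_upper.trans hV.le_final) d1
    ((a1.const_mul c).add (b1.const_mul (1 - c))) d2
    ((a2.const_mul c).add (b2.const_mul (1 - c))) ?_)
  intro A hA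
  have l1 := h₁.indicator (hV.le_upper _ hA)
  have l2 := h₂.indicator (hV.le_upper _ hA)
  have h3 := hV.evaluation.convex _ _ (fun _ => c) l1 l2 (linf_const c)
    (Eventually.of_forall fun _ => ⟨hc0, hc1⟩)
  have e : (fun _ => c) * A.indicator H₁ + (1 - fun _ => c) * A.indicator H₂ =
      A.indicator (fun ω => c * H₁ ω + (1 - c) * H₂ ω) := by
    ext ω; by_cases hω : ω ∈ A <;> simp [hω]
  rw [e] at h3
  rw [d3 A hA, integral_add (a2.const_mul c).integrableOn (b2.const_mul (1 - c)).integrableOn,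
    integral_const_mul, integral_const_mul, a3 A hA, b3 A hA, ← integral_const_mul,
    ← integral_const_mul, ← integral_add ((hV.integrable l1).const_mul c)
      ((hV.integrable l2).const_mul (1 - c))]
  exact integral_mono_ae (hV.integrable (hL.indicator (hV.le_upper _ hA)))
    (((hV.integrable l1).const_mul c).add ((hV.integrable l2).const_mul (1 - c)))
    (hV.ac.ae_le h3)

/-- Constant weights are handled by integration. Rounding `l` down to multiples of `1 / (n + 1)`
gives countably valued weights, to which constant weights extend by locality; `eventually_ge` bounds
`W` at the limit. -/
theorem convex (hV : IsMarketSplit P Q 𝓗 𝓢 𝓖 V) (hW : IsMarketDensity P Q 𝓗 𝓢 V W)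
    {H₁ H₂ l : Ω → ℝ} (h₁ : Linf P 𝓗 H₁) (h₂ : Linf P 𝓗 H₂) (hl : Linf P 𝓢 l)
    (hl01 : ∀ᵐ ω ∂P, 0 ≤ l ω ∧ l ω ≤ 1) :
    W (l * H₁ + (1 - l) * H₂) ≤ᵐ[P] l * W H₁ + (1 - l) * W H₂ := by
  have h1L : Linf P 𝓗 (1 : Ω → ℝ) := linf_const 1
  have hl𝓗 := hl.mono hV.le_upper
  have hL : Linf P 𝓗 (l * H₁ + (1 - l) * H₂) := (hl𝓗.mul h₁).add ((h1L.sub hl𝓗).mul h₂)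
  obtain ⟨l', hl', hll'⟩ := hl.1
  obtain ⟨C₁, hC₁⟩ := h₁.2
  obtain ⟨C₂, hC₂⟩ := h₂.2
  -- the weights `min (i / (n + 1)) 1`
  set c : ℕ → ℕ → ℝ := fun n i => min ((i : ℝ) / (n + 1)) 1 with hc
  have hc0 : ∀ n i, 0 ≤ c n i := fun n i => le_min (by positivity) zero_le_one
  have hc1 : ∀ n i, c n i ≤ 1 := fun n i => min_le_right _ _
  set Z : ℕ → ℕ → Ω → ℝ := fun n i ω => c n i * H₁ ω + (1 - c n i) * H₂ ω with hZ
  have hZL : ∀ n i, Linf P 𝓗 (Z n i) := fun n i =>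
    ((linf_const (c n i)).mul h₁).add ((linf_const (1 - c n i)).mul h₂)
  have hZC : ∀ n i, ∀ᵐ ω ∂P, |Z n i ω| ≤ max C₁ C₂ := by
    intro n i
    filter_upwards [hC₁, hC₂] with ω k1 k2
    have k3 := abs_add_le (c n i * H₁ ω) ((1 - c n i) * H₂ ω)
    rw [abs_mul, abs_mul, abs_of_nonneg (hc0 n i), abs_of_nonneg (sub_nonneg.2 (hc1 n i))] at k3
    have k4 := mul_le_mul_of_nonneg_left (k1.trans (le_max_left C₁ C₂)) (hc0 n i)
    have k5 := mul_le_mul_of_nonneg_left (k2.trans (le_max_right C₁ C₂)) (sub_nonneg.2 (hc1 n i))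
    refine k3.trans ((add_le_add k4 k5).trans (le_of_eq ?_))
    ring
  set ν : ℕ → Ω → ℕ := fun n ω => ⌊(n + 1 : ℝ) * l' ω⌋₊ with hν
  have hνm : ∀ n, Measurable[𝓢] (ν n) := fun n =>
    Nat.measurable_floor.comp ((continuous_const_mul (n + 1 : ℝ)).measurable.comp hl'.measurable)
  have hcl : ∀ᵐ ω ∂P, Tendsto (fun n => c n (ν n ω)) atTop (𝓝 (l ω)) := by
    filter_upwards [hll', hl01] with ω k1 k2
    rw [k1] at k2
    have k3 : ∀ n : ℕ, l' ω - 1 / (n + 1 : ℝ) ≤ c n (ν n ω) := by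
      intro n
      have hn : (0 : ℝ) < n + 1 := by positivity
      refine le_min ?_ ?_
      · rw [sub_le_iff_le_add, ← add_div, le_div_iff₀ hn, mul_comm]
        exact (Nat.lt_floor_add_one _).le
      · have : (0 : ℝ) ≤ 1 / (n + 1 : ℝ) := by positivity
        linarith [k2.2]
    have k4 : ∀ n : ℕ, c n (ν n ω) ≤ l' ω := by
      intro n
      have hn : (0 : ℝ) < n + 1 := by positivity
      refine (min_le_left _ _).trans ?_
      rw [div_le_iff₀ hn, mul_comm]
      exact Nat.floor_le (mul_nonneg hn.le k2.1)
    have k5 : Tendsto (fun n : ℕ => l' ω - 1 / (n + 1 : ℝ)) atTop (𝓝 (l' ω)) := by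
      simpa using tendsto_const_nhds.sub (tendsto_one_div_add_atTop_nhds_zero_nat (𝕜 := ℝ))
    rw [k1]
    exact tendsto_of_tendsto_of_tendsto_of_le_of_le k5 tendsto_const_nhds k3 k4
  have hconv : BoundedConv P 𝓗 (fun n ω => Z n (ν n ω) ω) (l * H₁ + (1 - l) * H₂) := by
    refine ⟨fun n => linf_select (hZL n) (hZC n) ((hνm n).mono hV.le_upper le_rfl), hL,
      ⟨max C₁ C₂, fun n => ?_⟩, ?_⟩
    · filter_upwards [ae_all_iff.2 (hZC n)] with ω k using k _
    · filter_upwards [hcl] with ω k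
      exact (k.mul_const _).add ((tendsto_const_nhds.sub k).mul_const _)
  have hsel : ∀ n, W (fun ω => Z n (ν n ω) ω) =ᵐ[P] fun ω => W (Z n (ν n ω)) ω := fun n =>
    (hW.isLocalMap hV).select hV.le_upper (hZL n) (hZC n) (hνm n)
  have hZW : ∀ n i, W (Z n i) ≤ᵐ[P] fun ω => c n i * W H₁ ω + (1 - c n i) * W H₂ ω := fun n i =>
    hW.convex_const hV h₁ h₂ (hc0 n i) (hc1 n i)
  have hge : ∀ j : ℕ, ∀ᵐ ω ∂P, ∀ᶠ n in atTop,
      W (l * H₁ + (1 - l) * H₂) ω - 1 / (j + 1 : ℝ) ≤ W (fun ω => Z n (ν n ω) ω) ω := fun j =>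
    hW.eventually_ge hV hconv (by positivity)
  filter_upwards [hcl, ae_all_iff.2 hsel, ae_all_iff.2 fun n => ae_all_iff.2 (hZW n),
    ae_all_iff.2 hge] with ω k1 k2 k3 k4
  have k5 : Tendsto (fun n => c n (ν n ω) * W H₁ ω + (1 - c n (ν n ω)) * W H₂ ω) atTop
      (𝓝 (l ω * W H₁ ω + (1 - l ω) * W H₂ ω)) :=
    (k1.mul_const _).add ((tendsto_const_nhds.sub k1).mul_const _)
  have k6 : ∀ j : ℕ, W (l * H₁ + (1 - l) * H₂) ω - 1 / (j + 1 : ℝ) ≤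
      l ω * W H₁ ω + (1 - l ω) * W H₂ ω := fun j =>
    ge_of_tendsto k5 ((k4 j).mono fun n hn => hn.trans ((k2 n).le.trans (k3 n _)))
  have k7 : Tendsto (fun j : ℕ => W (l * H₁ + (1 - l) * H₂) ω - 1 / (j + 1 : ℝ)) atTop
      (𝓝 (W (l * H₁ + (1 - l) * H₂) ω)) := by
    simpa using tendsto_const_nhds.sub (tendsto_one_div_add_atTop_nhds_zero_nat (𝕜 := ℝ))
  exact le_of_tendsto' k7 k6

/-- On events of `𝓖` the evaluation `V` is itself local, so its integrals over them agree with those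
defining the density. -/
theorem condExp_eq (hV : IsMarketSplit P Q 𝓗 𝓢 𝓖 V) (hW : IsMarketDensity P Q 𝓗 𝓢 V W)
    {H : Ω → ℝ} (hH : Linf P 𝓗 H) : V H =ᵐ[P] Q[W H | 𝓖] := by
  have := hV.prob
  have h𝓖 : 𝓖 ≤ m := hV.le_lower.trans (hV.le_upper.trans hV.le_final)
  obtain ⟨a1, a2, a3⟩ := hW H hH
  refine hV.ac'.ae_le (ae_eq_condExp_of_forall_setIntegral_eq h𝓖 a2
    (fun A _ _ => (hV.integrable hH).integrableOn) (fun A hA _ => ?_)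
    ((hV.evaluation.mem H hH).1.mono_ac hV.ac))
  rw [a3 A (hV.le_lower _ hA), ← integral_indicator (h𝓖 _ hA)]
  exact integral_congr_ae (hV.ac.ae_le (hV.evaluation.indicator hH hA).symm)

/-- The densities form a conditional evaluation if they are bounded. -/
theorem isConditionalEvaluation (hV : IsMarketSplit P Q 𝓗 𝓢 𝓖 V)
    (hW : IsMarketDensity P Q 𝓗 𝓢 V W)
    (hb : ∀ H, Linf P 𝓗 H → ∃ K : ℝ, ∀ᵐ ω ∂P, |W H ω| ≤ K) :
    IsConditionalEvaluation P 𝓗 𝓢 W where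
  mem H hH := ⟨(hW H hH).1.aestronglyMeasurable, hb H hH⟩
  congr _ _ h₁ h₂ h := hW.congr hV h₁ h₂ h
  normalized := hW.normalized hV
  cash _ _ hH hc := hW.cash hV hH hc
  convex _ _ _ h₁ h₂ hl h := hW.convex hV h₁ h₂ hl h
  isLocal := (hW.isLocalMap hV).isLocal
  fatou _ _ h := hW.fatou hV h

end IsMarketDensity

theorem IsConditionalEvaluation.restrict {𝓗' : MeasurableSpace Ω}
    (hV : IsConditionalEvaluation P 𝓗 𝓖 V) (h : 𝓗' ≤ 𝓗) : IsConditionalEvaluation P 𝓗' 𝓖 V where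
  mem H hH := hV.mem H (hH.mono h)
  congr _ _ h₁ h₂ := hV.congr _ _ (h₁.mono h) (h₂.mono h)
  normalized := hV.normalized
  cash _ _ hH hc := hV.cash _ _ (hH.mono h) hc
  convex _ _ _ h₁ h₂ := hV.convex _ _ _ (h₁.mono h) (h₂.mono h)
  isLocal _ _ _ h₁ h₂ := hV.isLocal _ _ _ (h₁.mono h) (h₂.mono h)
  fatou _ _ hc := hV.fatou _ _
    ⟨fun k => (hc.seq_mem k).mono h, hc.lim_mem.mono h, hc.bounded, hc.tendsto⟩

end DensityProperties

/-! ### The density as limit of the evaluations before the jump, and its boundedness -/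

section TwoStep

variable {Ω : Type*} {m : MeasurableSpace Ω} {P Q : Measure Ω}
  {𝓕 𝓕S : Filtration ℝ≥0 m} {T : ℝ≥0} {V : BddStoppingTime 𝓕 T → (Ω → ℝ) → Ω → ℝ}
  {W : (Ω → ℝ) → Ω → ℝ} {𝓢 : MeasurableSpace Ω} {σ τ : BddStoppingTime 𝓕 T}

/-- Conditioning the density on the past of a stopping time before the next jump gives back the
evaluation at this time. -/
theorem IsMarketDensity.condExp_past (hW : IsMarketDensity P Q (𝓕 T) 𝓢 (V σ) W)
    (hD : IsMarketSplit P Q (𝓕 T) 𝓢 σ.past (V σ)) (hV : IsDynamicEvaluation P T 𝓕 V)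
    (hmc : IsMarketConsistent P Q T 𝓕 𝓕S V) {ρ : BddStoppingTime 𝓕 T}
    (hσρ : ∀ ω, σ.val ω ≤ ρ.val ω) (hρ𝓢 : ρ.past ≤ 𝓢) (hρ : ρ.past ≤ 𝓕S T ⊔ σ.past)
    {H : Ω → ℝ} (hH : Linf P (𝓕 T) H) : V ρ H =ᵐ[P] Q[W H | ρ.past] := by
  have := hD.prob
  obtain ⟨a1, a2, a3⟩ := hW H hH
  have hE := hV.evaluation ρ
  have hi : ∀ K, Linf P (𝓕 T) K → Integrable (V ρ K) Q := fun K hK =>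
    (hE.mem K hK).integrable hD.ac ρ.past_le
  refine hD.ac'.ae_le (ae_eq_condExp_of_forall_setIntegral_eq ρ.past_le a2
    (fun A _ _ => (hi H hH).integrableOn) (fun A hA _ => ?_)
    ((hE.mem H hH).1.mono_ac hD.ac))
  have hAH := hH.indicator (ρ.past_le_final _ hA)
  have h1 := hV.time_consistent σ ρ hσρ _ hAH
  have h2 := hmc.eq_condExp hV σ ((hE.mem _ hAH).mono hρ)
  rw [a3 A (hρ𝓢 _ hA), integral_congr_ae (hD.ac.ae_le (h1.trans h2)),
    integral_condExp σ.past_le, integral_congr_ae (hD.ac.ae_le (hE.indicator hH hA)),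
    integral_indicator (ρ.past_le _ hA)]

theorem ae_bdd_condExp_on {𝓖 : MeasurableSpace Ω} {f : Ω → ℝ} (hf : Integrable f Q)
    {D : Set Ω} (hD : MeasurableSet[𝓖] D) {c : ℝ} (h : ∀ᵐ ω ∂Q, ω ∈ D → |f ω| ≤ c) :
    ∀ᵐ ω ∂Q, ω ∈ D → |(Q[f | 𝓖]) ω| ≤ c := by
  rcases lt_or_ge c 0 with hc | hc
  · filter_upwards [h] with ω h hω
    exact absurd ((abs_nonneg _).trans (h hω)) hc.not_ge
  · have h1 : ∀ᵐ ω ∂Q, |D.indicator f ω| ≤ c := by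
      filter_upwards [h] with ω h
      by_cases hω : ω ∈ D
      · simpa [hω] using h hω
      · simpa [hω] using hc
    filter_upwards [ae_bdd_abs_condExp_of_ae_bdd_abs (m := 𝓖) h1, condExp_indicator hf hD] with ω h2 h3 hω
    rw [h3, Set.indicator_of_mem hω] at h2
    exact h2

/-- The martingale `E_Q[W H | 𝓕_{ρ k}]` converges to `W H` because `W H` is measurable over the
union of the pasts, and it equals `V (ρ k) H`, which is bounded along disjoint events. The gliding
hump lemma applies. -/
theorem IsMarketDensity.ae_bounded (hW : IsMarketDensity P Q (𝓕 T) 𝓢 (V σ) W)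
    (hD : IsMarketSplit P Q (𝓕 T) 𝓢 σ.past (V σ)) (hV : IsDynamicEvaluation P T 𝓕 V)
    (hmc : IsMarketConsistent P Q T 𝓕 𝓕S V) {ρ : ℕ → BddStoppingTime 𝓕 T}
    (hmono : ∀ ω, Monotone fun k => (ρ k).val ω) (hσρ : ∀ k ω, σ.val ω ≤ (ρ k).val ω)
    (hρτ : ∀ k ω, (ρ k).val ω ≤ τ.val ω) (h𝓢 : 𝓢 = ⨆ k, (ρ k).past)
    (hρ : ∀ k, (ρ k).past ≤ 𝓕S T ⊔ σ.past)
    {H : Ω → ℝ} (hH : Linf P (𝓕 T) H) : ∃ K, ∀ᵐ ω ∂P, |W H ω| ≤ K := by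
  have := hD.prob
  obtain ⟨a1, a2, -⟩ := hW H hH
  have hρ𝓢 : ∀ k, (ρ k).past ≤ 𝓢 := fun k => h𝓢 ▸ le_iSup (fun k => (ρ k).past) k
  have heq : ∀ k, V (ρ k) H =ᵐ[P] Q[W H | (ρ k).past] := fun k =>
    hW.condExp_past hD hV hmc (hσρ k) (hρ𝓢 k) (hρ k) hH
  refine ae_bounded_of_forall_disjoint (pastFiltration ρ hmono)
    (M := fun k => Q[W H | (ρ k).past])
    (fun k => (stronglyMeasurable_condExp (m := (ρ k).past)).measurable) ?_ ?_ ?_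
  · rw [h𝓢] at a1
    exact hD.ac'.ae_le (a2.tendsto_ae_condExp (ℱ := pastFiltration ρ hmono) a1)
  · intro k D c hDm h
    exact hD.ac'.ae_le (ae_bdd_condExp_on a2 hDm (hD.ac.ae_le h))
  · intro E κ hE hd
    obtain ⟨K, hK⟩ := hV.bounded_on_disjoint hρτ hE hd hH
    refine ⟨K, fun j => ?_⟩
    filter_upwards [hK j, heq (κ j)] with ω h1 h2
    rwa [← h2]

end TwoStep

end MarketEval

end

/-! ### The main theorem -/

theorem mainTheorem3 {Ω : Type*} [m : MeasurableSpace Ω] (P : Measure Ω) [IsProbabilityMeasure P]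
    (n : ℕ) (T : ℝ≥0) (hT : 0 < T)
    (S : ℝ≥0 → Ω → Fin n → ℝ) (hS : ∀ t, StronglyMeasurable (S t))
    (Y : ℝ≥0 → Ω → ℝ) (hY : ∀ t, StronglyMeasurable (Y t))
    (𝓕S 𝓕Y 𝓕 : Filtration ℝ≥0 m)
    (h𝓕S : 𝓕S = MarketEval.generatedFiltration P S hS)
    (h𝓕Y : 𝓕Y = MarketEval.generatedFiltration P Y hY)
    (h𝓕 : 𝓕 = 𝓕S ⊔ 𝓕Y)
    (hScont : ∀ ω, ContinuousOn (fun t => S t ω) (Set.Iic T))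
    (hYins : MarketEval.IsInsuranceProcess P T 𝓕 𝓕Y Y)
    (Q : Measure Ω) (hQ : MarketEval.IsPricingMeasure P T 𝓕S S Q)
    (V : MarketEval.BddStoppingTime 𝓕 T → (Ω → ℝ) → Ω → ℝ)
    (hV : MarketEval.IsDynamicEvaluation P T 𝓕 V)
    (hVmc : MarketEval.IsMarketConsistent P Q T 𝓕 𝓕S V)
    (hVcont : ∀ σ, MarketEval.IsContinuousEval P (𝓕 T) (V σ)) :
    ∀ σ : MarketEval.BddStoppingTime 𝓕 T,
      ∃ τ : MarketEval.BddStoppingTime 𝓕 T,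
        τ.val = MarketEval.nextJump T Y σ.val ∧
        MarketEval.MarketLocalProperty P τ.past
          (MarketEval.stoppedInfo S τ.val ⊔ σ.past) (V σ) ∧
        (((∀ ρ, MarketEval.IsMonotoneEval P (𝓕 T) (V ρ)) ∨
          (∀ ρ, MarketEval.IsPNormBounded P (𝓕 T) ρ.past (V ρ)) ∨
          (∀ ρ, MarketEval.IsPosHomEval P (𝓕 T) ρ.past (V ρ))) →
          MarketEval.IsTwoStepMarketEvaluation P Q τ.past
            (MarketEval.stoppedInfo S τ.val ⊔ σ.past) σ.past (V σ)) := by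

  have := hQ.isMartingaleMeasure.isProb
  have hSF : 𝓕S ≤ 𝓕 := h𝓕 ▸ le_sup_left
  subst h𝓕S
  have hn : ∀ t, MarketEval.nullEvents P ≤ 𝓕 t := fun t =>
    (MarketEval.nullEvents_le_generatedFiltration t).trans (hSF t)
  intro σ
  obtain ⟨τ, hτ⟩ : ∃ τ : MarketEval.BddStoppingTime 𝓕 T,
      τ.val = MarketEval.nextJump T Y σ.val :=
    ⟨⟨_, hYins.isStoppingTime_nextJump hn hY σ, MarketEval.nextJump_le σ.val⟩, rfl⟩
  obtain ⟨ρ, hρ⟩ := hYins.exists_announces σ τ hτ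
  -- The market information up to the next jump is exactly what is known strictly before it.
  have h𝓢 : MarketEval.stoppedInfo S τ.val ⊔ σ.past = ⨆ k, (ρ k).past :=
    le_antisymm (hρ.stoppedInfo_le h𝓕 hScont)
      (iSup_le (hρ.past_le_stoppedInfo h𝓕 h𝓕Y hScont hYins))
  have hρS := hρ.past_le_stock_sup_past h𝓕 h𝓕Y hYins
  have hσ𝓢 : MarketEval.stoppedInfo S τ.val ⊔ σ.past ≤
      MarketEval.generatedFiltration P S hS T ⊔ σ.past := h𝓢.trans_le (iSup_le hρS)
  have hsplit : ∀ A H, MeasurableSet[MarketEval.stoppedInfo S τ.val ⊔ σ.past] A →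
      MarketEval.Linf P (𝓕 T) H → V σ H =ᵐ[P] V σ (A.indicator H) + V σ (Aᶜ.indicator H) :=
    fun A H hA hH => hVmc.split hV hSF (hVcont σ) hρ.mono hρ.ge hρS (h𝓢 ▸ hA) hH
  refine ⟨τ, hτ, fun A H hA hH => hsplit A H hA (hH.1.mono τ.past_le_final), fun hcase => ?_⟩
  have hσT : σ.past ≤ 𝓕 T := σ.past_le_final
  -- The density is built on all of `L^∞(𝓕_T)`, where time-consistency and market-consistency are
  -- available, and is restricted to payoffs known at `τ` only at the end.
  have hD : MarketEval.IsMarketSplit P Q (𝓕 T) (MarketEval.stoppedInfo S τ.val ⊔ σ.past) σ.past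
      (V σ) :=
    { evaluation := hV.evaluation σ
      le_final := 𝓕.le T
      le_upper := hσ𝓢.trans (sup_le (hSF T) hσT)
      le_lower := le_sup_right
      prob := this
      ac := hQ.isMartingaleMeasure.ac
      ac' := hQ.isMartingaleMeasure.ac'
      split := hsplit
      continuous := hVcont σ
      bounded := by
        rcases hcase with h | h | h
        · exact (h σ).isUniformlyBounded (hV.evaluation σ)
        · exact (h σ).isUniformlyBounded (hV.evaluation σ) (𝓕.le T)
        · exact (h σ).isUniformlyBounded (hV.evaluation σ) hσT (hVcont σ)
      price := fun c H hc hH => hVmc σ c H (hc.mono hσ𝓢) hH }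
  obtain ⟨W, hW⟩ := hD.exists_isMarketDensity
  have hWE := hW.isConditionalEvaluation hD fun H hH =>
    hW.ae_bounded hD hV hVmc hρ.mono hρ.ge hρ.le h𝓢 hρS hH
  exact ⟨W, hWE.restrict τ.past_le_final, fun H hH => hW.condExp_eq hD (hH.mono τ.past_le_final)⟩
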